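/- Let $\mathcal H$ be a reproducing kernel Hilbert space of real functions on a measurable space $\mathcal X$ with reproducing kernel $K$, where $K$ is measurable on $\mathcal X\times\mathcal X$; write $\Phi(x)=K(x,\cdot)$. Assume $(\mathscr A_1)$: $\sup_{x,y}K(x,y)<+\infty$. Let $k\ge 1$ and, for $j=1,\dots,k$, let $X^{(j)}_1,X^{(j)}_2,\dots$ be i.i.d. random variables in $\mathcal X$ with distribution $\mathbb P_j$, the $k$ sequences being mutually independent. For sample sizes $n_1,\dots,n_k$ put $n=\sum_j n_j$ and $$\widehat\Gamma_{j\ell}=\sum_{i=1}^{n_j}\sum_{\substack{r=1\\ r\ne i}}^{n_j}\frac{K(X^{(j)}_i,X^{(j)}_r)}{n_j(n_j-1)}+\sum_{i=1}^{n_\ell}\sum_{\substack{r=1\\ r\neq i}}^{n_\ell}\frac{K(X^{(\ell)}_i,X^{(\ell)}_r)}{n_\ell(n_\ell-1)}-2\sum_{i=1}^{n_j}\sum_{r=1}^{n_\ell}\frac{K(X^{(j)}_i,X^{(\ell)}_r)}{n_jn_\ell},\qquad \widehat T_n=\sum_{j=1}^k\sum_{\substack{\ell=1\\ \ell\ne j}}^k\frac{n_\ell}{n}\,\widehat\Gamma_{j\ell}.$$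 Let the sample sizes vary along a sequence with $\min_j n_j\to\infty$ and assume $(\mathscr A_2)$: $n_j/n\to\rho_j\in(0,1)$ for every $j$. Assume the null hypothesis $\mathbb P_1=\dots=\mathbb P_k=:\mathbb P$. Let $m\in\mathcal H$ be the mean element of $\mathbb P$, i.e. $\langle m,f\rangle_{\mathcal H}=\int f\,d\mathbb P$ for all $f\in\mathcal H$, let $\widetilde K(x,y)=\langle\Phi(x)-m,\Phi(y)-m\rangle_{\mathcal H}$, and let $(\lambda_p)_{p\ge1}$ be the sequence of eigenvalues of the integral operator $f\mapsto\int\widetilde K(\cdot,y)f(y)\,d\mathbb P(y)$ on $L^2(\mathbb P)$, every nonzero eigenvalue being repeated according to its multiplicity (in any order, with any further entries equal to $0$). Let $(Y_{p,j})_{p\ge1,\,1\le j\le k}$ be independent $\mathcal N(0,1)$ random variables and $Z_p=\sum_{j=1}^kY_{p,j}^2$. Then the $Z_p$ are independent with the $\chi^2_k$ distribution, the series below converges almost surely, and $$n\widehat T_n\ \xrightarrow{\ \mathscr D\ }\ \sum_{p=1}^{\infty}\lambda_p\Big\{(k-2)(Z_p-k)+\sum_{j=1}^k\Big[\rho_j^{-1}(Y_{p,j}^2-1)-2\sum_{\substack{\ell=1\\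 \ell\ne j}}^k\rho_\ell^{1/2}\rho_j^{-1/2}\,Y_{p,j}Y_{p,\ell}\Big]\Big\}.$$ In particular, for $k=2$ and $\{i,j\}=\{1,2\}$, $$n\widehat\Gamma_{ij}\ \xrightarrow{\ \mathscr D\ }\ \sum_{p=1}^\infty\lambda_p\Big\{\big(\rho_i^{-1/2}Y_{p,i}-\rho_j^{-1/2}Y_{p,j}\big)^2-(\rho_i\rho_j)^{-1}\Big\},$$ the series again converging almost surely. -/

import Mathlib

open MeasureTheory ProbabilityTheory Filter Topology

noncomputable section

namespace KSample

/-! ### Reproducing kernel Hilbert space: feature map, kernel, mean element, centered kernel -/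

section Kernel

variable {𝒳 : Type*} (H : Type*) [NormedAddCommGroup H] [InnerProductSpace ℝ H]
  [CompleteSpace H] [RKHS ℝ H 𝒳 ℝ]

/-- The feature map `Φ x = K(x, ·)` of a real reproducing kernel Hilbert space. -/
def featureMap (x : 𝒳) : H := RKHS.kerFun H x (1 : ℝ)

/-- The real-valued reproducing kernel `K` of `H` (Mathlib's kernel takes its values in the
continuous linear maps `ℝ →L[ℝ] ℝ`). -/
def kern (x y : 𝒳) : ℝ := RKHS.kernel H x y (1 : ℝ)

/-- The reproducing property `f x = ⟪f, Φ x⟫`. -/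
theorem inner_featureMap (f : H) (x : 𝒳) : inner ℝ f (featureMap H x) = f x := by
  simp [featureMap]

/-- The feature map consists of the functions `K(x, ·)`. -/
theorem featureMap_apply (x y : 𝒳) : featureMap H x y = kern H x y := by
  rw [← inner_featureMap, featureMap, kern, real_inner_comm, featureMap,
    ← RKHS.kernel_inner]
  simp

/-- The kernel is `K(x, y) = ⟪Φ x, Φ y⟫`. -/
theorem kern_eq_inner (x y : 𝒳) :
    kern H x y = inner ℝ (featureMap H x) (featureMap H y) := by
  rw [inner_featureMap, featureMap_apply]

variable [MeasurableSpace 𝒳]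

/-- `m` is a mean element of the distribution `P`: `⟪m, f⟫ = ∫ f dP` for all `f` in `H`. -/
def IsMeanElement (P : Measure 𝒳) (m : H) : Prop :=
  ∀ f : H, Integrable (fun x => f x) P ∧ inner ℝ m f = ∫ x, f x ∂P

open Classical in
/-- The mean element of `P`, unique since its inner products are given (with the value `0` if
there is none). -/
def meanElement (P : Measure 𝒳) : H :=
  if h : ∃ m : H, IsMeanElement H P m then h.choose else 0

/-- The centered kernel `⟪Φ x - m, Φ y - m⟫`, where `m` is the mean element of `P`. -/
def centeredKern (P : Measure 𝒳) (x y : 𝒳) : ℝ :=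
  inner ℝ (featureMap H x - meanElement H P) (featureMap H y - meanElement H P)

end Kernel

/-! ### Eigenvalues of an integral operator -/

section Eigenvalues

variable {𝒳 : Type*} [MeasurableSpace 𝒳]

/-- The eigenspace, for the real number `c`, of the integral operator
`(S f)(x) = ∫ k(x, y) f(y) dP(y)` on `L²(P)`. -/
def integralEigenspace (k : 𝒳 → 𝒳 → ℝ) (P : Measure 𝒳) (c : ℝ) :
    Submodule ℝ (Lp ℝ 2 P) where
  carrier := {f | ∀ᵐ x ∂P, Integrable (fun y => k x y * f y) P ∧
    ∫ y, k x y * f y ∂P = c * f x}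
  zero_mem' := by
    have h0 := Lp.coeFn_zero ℝ 2 P
    filter_upwards [h0] with x hx
    have hk : (fun y => k x y * (0 : Lp ℝ 2 P) y) =ᵐ[P] fun _ => (0 : ℝ) := by
      filter_upwards [h0] with y hy
      rw [hy, Pi.zero_apply, mul_zero]
    refine ⟨(integrable_zero 𝒳 ℝ P).congr hk.symm, ?_⟩
    rw [integral_congr_ae hk, hx]
    simp
  add_mem' := by
    intro f g hf hg
    have ha := Lp.coeFn_add f g
    filter_upwards [hf, hg, ha] with x hxf hxg hx
    have hk : (fun y => k x y * (f + g : Lp ℝ 2 P) y) =ᵐ[P]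
        fun y => k x y * f y + k x y * g y := by
      filter_upwards [ha] with y hy
      rw [hy, Pi.add_apply, mul_add]
    refine ⟨(hxf.1.add hxg.1).congr hk.symm, ?_⟩
    rw [integral_congr_ae hk, integral_add hxf.1 hxg.1, hxf.2, hxg.2, hx, Pi.add_apply, mul_add]
  smul_mem' := by
    intro a f hf
    have hs := Lp.coeFn_smul a f
    filter_upwards [hf, hs] with x hxf hx
    have hk : (fun y => k x y * (a • f : Lp ℝ 2 P) y) =ᵐ[P]
        fun y => a * (k x y * f y) := by
      filter_upwards [hs] with y hy
      simp [hy, mul_left_comm]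
    refine ⟨(hxf.1.const_mul a).congr hk.symm, ?_⟩
    rw [integral_congr_ae hk, integral_const_mul, hxf.2, hx]
    simp [mul_left_comm]

/-- `lam` is a sequence of the eigenvalues of the integral operator with kernel `k` on `L²(P)`:
every nonzero real number occurs in it as often as its multiplicity as an eigenvalue says
(and never if it is no eigenvalue). The remaining entries, if there are any, are `0`. -/
def IsEigenvalueSeq (k : 𝒳 → 𝒳 → ℝ) (P : Measure 𝒳) (lam : ℕ → ℝ) : Prop :=
  ∀ c : ℝ, c ≠ 0 →
    {p : ℕ | lam p = c}.encard = Cardinal.toENat (Module.rank ℝ (integralEigenspace k P c))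

end Eigenvalues

/-! ### The test statistic -/

section Statistic

variable {𝒳 Ω : Type*} {k : ℕ}

/-- The unbiased estimator of the squared maximum mean discrepancy between the distributions
number `j` and `l`, from the first `n j` and `n l` points of the samples `X j` and `X l`. -/
def mmdU (K : 𝒳 → 𝒳 → ℝ) (X : Fin k → ℕ → Ω → 𝒳) (n : Fin k → ℕ) (j l : Fin k) (ω : Ω) : ℝ :=
  (∑ i ∈ Finset.range (n j), ∑ r ∈ (Finset.range (n j)).erase i,
      1 / ((n j : ℝ) * ((n j : ℝ) - 1)) * K (X j i ω) (X j r ω))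
  + (∑ i ∈ Finset.range (n l), ∑ r ∈ (Finset.range (n l)).erase i,
      1 / ((n l : ℝ) * ((n l : ℝ) - 1)) * K (X l i ω) (X l r ω))
  - 2 * ∑ i ∈ Finset.range (n j), ∑ r ∈ Finset.range (n l),
      1 / ((n j : ℝ) * (n l : ℝ)) * K (X j i ω) (X l r ω)

/-- The total sample size, as a real number. -/
def totalSize (n : Fin k → ℕ) : ℝ := ∑ j, (n j : ℝ)

/-- The test statistic `T̂ = ∑_j ∑_{l ≠ j} (n_l / n) Γ̂_{jl}`. -/
def testStat (K : 𝒳 → 𝒳 → ℝ) (X : Fin k → ℕ → Ω → 𝒳) (n : Fin k → ℕ) (ω : Ω) : ℝ :=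
  ∑ j, ∑ l ∈ Finset.univ.erase j, (n l : ℝ) / totalSize n * mmdU K X n j l ω

end Statistic

/-! ### The limit -/

section Limit

variable {Ω : Type*} {k : ℕ}

/-- The chi-squared distribution with `k` degrees of freedom: the law of the sum of the squares
of `k` independent standard normal variables. -/
def chiSquared (k : ℕ) : Measure ℝ :=
  (Measure.pi fun _ : Fin k => gaussianReal 0 1).map fun x => ∑ j, x j ^ 2

/-- `Z_p = ∑_j Y_{p,j}²`. -/
def sumSq (Y : ℕ → Fin k → Ω → ℝ) (p : ℕ) (ω : Ω) : ℝ := ∑ j, Y p j ω ^ 2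

/-- The `p`-th term of the limiting series. -/
def limitTerm (lam : ℕ → ℝ) (ρ : Fin k → ℝ) (Y : ℕ → Fin k → Ω → ℝ) (p : ℕ) (ω : Ω) : ℝ :=
  lam p * (((k : ℝ) - 2) * (sumSq Y p ω - k)
    + ∑ j, ((ρ j)⁻¹ * (Y p j ω ^ 2 - 1)
      - 2 * ∑ l ∈ Finset.univ.erase j, √(ρ l) * (√(ρ j))⁻¹ * Y p j ω * Y p l ω))

end Limit

end KSample

end

/-! Under the null hypothesis the kernel may be centered. The difference between `K(x,y)` and
`K̃(x,y)` is `m(x) + m(y) - ‖m‖²`, and these functions of one variable cancel in every `Γ̂_{jℓ}` as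
soon as all `n_j ≥ 2` (`mmdU_eq_of_kernel_eq`). Both `n T̂_n` and, for `k = 2`, `n Γ̂_{ij}` then
take the form `∑ c_{jℓ} C_{jℓ}`. Here `C_{jℓ}` is `(n_j n_ℓ)^{-1/2}` times the sum of `K̃` over
pairs of distinct points, and the coefficients converge by `(𝒜₂)`. One limit theorem for such forms,
`tendstoInDistribution_quadStat`, covers both claims.

The spectral input is a Mercer expansion. The map `T f = ⟪f, Φ - m⟫` from `H` to `L²(P)` is
Hilbert–Schmidt because `Φ - m` is bounded, and the integral operator of `K̃` is `T T*`. It is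
therefore compact and symmetric with summable eigenvalues, and `K̃ = ∑ λ_p φ_p ⊗ φ_p` in `L²(P ⊗
P)`, where the `φ_p` with `λ_p ≠ 0` are centered, bounded and orthonormal (`exists_eigenfunctions`).

For the kernel truncated at `p < L`, `C_{jℓ}` equals `∑ λ_p (S_{p,j} S_{p,ℓ} - 1_{j=ℓ} M_{p,j})`,
with normalized sums `S` and averages `M` of `φ_p²`. The central limit theorem gives `S → Y`, the
law of large numbers gives `M → 1`, and continuous mapping gives the truncated limit.

The remainder kernel is still degenerate, so summands over different unordered pairs are
uncorrelated and `E C_{jℓ}² ≤ 2 ∫ (K̃ - K̃_L)²`, uniformly in the sample sizes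
(`integral_crossStat_sq_le`). The characteristic functions are thus uniformly close, and `L → ∞` may
be taken after `N → ∞` (`tendsto_of_forall_approx`). The limiting series converges almost surely
because `∑ |λ_p| < ∞`. -/

noncomputable section

namespace KSample

/-! ### Bounded feature maps and the Hilbert–Schmidt property -/

section BoundedFeature

variable {𝒳 : Type*} [MeasurableSpace 𝒳] {H : Type*} [NormedAddCommGroup H]
  [InnerProductSpace ℝ H]

/-- A bounded map into a Hilbert space that is weakly measurable and has a jointly measurable
Gram kernel. -/
structure IsBoundedFeature (Ψ : 𝒳 → H) (B : ℝ) : Prop where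
  measurable_inner : ∀ f : H, Measurable fun x => inner ℝ f (Ψ x)
  measurable_gram : Measurable fun z : 𝒳 × 𝒳 => inner ℝ (Ψ z.1) (Ψ z.2)
  norm_le : ∀ x, ‖Ψ x‖ ≤ B

namespace IsBoundedFeature

variable {Ψ : 𝒳 → H} {B : ℝ} (hΨ : IsBoundedFeature Ψ B)
  (P : Measure 𝒳) [IsProbabilityMeasure P]

include hΨ

theorem abs_inner_le (f : H) (x : 𝒳) : ‖inner ℝ f (Ψ x)‖ ≤ B * ‖f‖ :=
  (norm_inner_le_norm f (Ψ x)).trans <| by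
    rw [mul_comm]; exact mul_le_mul_of_nonneg_right (hΨ.norm_le x) (norm_nonneg f)

theorem memLp (f : H) : MemLp (fun x => inner ℝ f (Ψ x)) 2 P :=
  MemLp.of_bound (hΨ.measurable_inner f).aestronglyMeasurable (B * ‖f‖)
    (ae_of_all _ (hΨ.abs_inner_le f))

theorem norm_toLp_le (f : H) : ‖(hΨ.memLp P f).toLp‖ ≤ B * ‖f‖ := by
  have h := Lp.norm_le_of_ae_bound (f := (hΨ.memLp P f).toLp) (C := B * ‖f‖)
    (mul_nonneg ((norm_nonneg _).trans (hΨ.norm_le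
      (MeasureTheory.nonempty_of_isProbabilityMeasure P).some)) (norm_nonneg f)) (by
      filter_upwards [(hΨ.memLp P f).coeFn_toLp] with x hx
      rw [hx]; exact hΨ.abs_inner_le f x)
  simpa [measureUnivNNReal] using h

/-- The inclusion `f ↦ ⟪f, Ψ ·⟫` into `L²`. -/
def toL2 : H →L[ℝ] Lp ℝ 2 P :=
  LinearMap.mkContinuous
    { toFun := fun f => (hΨ.memLp P f).toLp
      map_add' := fun f g => by
        rw [← MemLp.toLp_add]
        exact MemLp.toLp_congr _ _ (ae_of_all _ fun x => by simp [inner_add_left])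
      map_smul' := fun c f => by
        rw [RingHom.id_apply, ← MemLp.toLp_const_smul]
        exact MemLp.toLp_congr _ _ (ae_of_all _ fun x => by simp [inner_smul_left]) }
    B (hΨ.norm_toLp_le P)

theorem norm_toL2_le (f : H) : ‖hΨ.toL2 P f‖ ≤ B * ‖f‖ :=
  hΨ.norm_toLp_le P f

theorem coeFn_toL2 (f : H) : hΨ.toL2 P f =ᵐ[P] fun x => inner ℝ f (Ψ x) :=
  (hΨ.memLp P f).coeFn_toLp

theorem inner_toL2 (f : H) (u : Lp ℝ 2 P) :
    inner ℝ (hΨ.toL2 P f) u = ∫ x, inner ℝ f (Ψ x) * u x ∂P := by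
  rw [L2.inner_def]
  refine integral_congr_ae ?_
  filter_upwards [hΨ.coeFn_toL2 P f] with x hx
  rw [hx]; simp [mul_comm]

theorem norm_toL2_sq (f : H) : ‖hΨ.toL2 P f‖ ^ 2 = ∫ x, inner ℝ f (Ψ x) ^ 2 ∂P := by
  rw [← real_inner_self_eq_norm_sq, inner_toL2]
  refine integral_congr_ae ?_
  filter_upwards [hΨ.coeFn_toL2 P f] with x hx
  rw [hx, sq]

theorem integrable_sq (f : H) : Integrable (fun x => inner ℝ f (Ψ x) ^ 2) P :=
  (hΨ.memLp P f).integrable_sq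

/-- The sum is the integral of `∑ ⟪e i, Ψ x⟫²`, which Bessel's inequality bounds pointwise by `‖Ψ
x‖²`. The bound does not depend on the orthonormal family, so the map into `L²` is Hilbert–Schmidt.
-/
theorem sum_norm_toL2_sq_le {ι : Type*} {e : ι → H} (he : Orthonormal ℝ e) (s : Finset ι) :
    ∑ i ∈ s, ‖hΨ.toL2 P (e i)‖ ^ 2 ≤ B ^ 2 := by
  simp_rw [norm_toL2_sq]
  rw [← integral_finsetSum _ fun i _ => hΨ.integrable_sq P (e i)]
  have h : ∀ x, ∑ i ∈ s, inner ℝ (e i) (Ψ x) ^ 2 ≤ B ^ 2 := fun x => by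
    have h1 := he.sum_inner_products_le (Ψ x) (s := s)
    simp only [Real.norm_eq_abs, sq_abs] at h1
    exact h1.trans (pow_le_pow_left₀ (norm_nonneg _) (hΨ.norm_le x) 2)
  calc ∫ x, ∑ i ∈ s, inner ℝ (e i) (Ψ x) ^ 2 ∂P ≤ ∫ _, B ^ 2 ∂P :=
        integral_mono (integrable_finsetSum _ fun i _ => hΨ.integrable_sq P (e i))
          (integrable_const _) h
    _ = B ^ 2 := by simp

end IsBoundedFeature

end BoundedFeature

/-- A Hilbert–Schmidt operator is compact. -/
theorem isCompactOperator_of_sum_norm_sq_le {H F : Type*} [NormedAddCommGroup H]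
    [InnerProductSpace ℝ H] [NormedAddCommGroup F] [NormedSpace ℝ F] [CompleteSpace F]
    (T : H →L[ℝ] F) {C : ℝ}
    (hT : ∀ (n : ℕ) (e : Fin n → H), Orthonormal ℝ e → ∑ i, ‖T (e i)‖ ^ 2 ≤ C) :
    IsCompactOperator T := by
  let A : Set ℝ := {a | ∃ (n : ℕ) (e : Fin n → H), Orthonormal ℝ e ∧ a = ∑ i, ‖T (e i)‖ ^ 2}
  have hA0 : A.Nonempty := ⟨_, 0, ![], ⟨fun i => i.elim0, fun i => i.elim0⟩, rfl⟩
  have hA1 : BddAbove A := ⟨C, by rintro _ ⟨n, e, he, rfl⟩; exact hT n e he⟩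
  have key : T ∈ closure {S : H →L[ℝ] F | IsCompactOperator S} := by
    rw [Metric.mem_closure_iff]
    intro ε hε
    -- A nearly maximal orthonormal family: one further unit vector can add less than `(ε / 2) ^ 2`
    -- to the sum. Hence `T` has norm at most `ε / 2` on the orthogonal complement of the span, and
    -- composing `T` with the projection onto the span gives a finite-rank approximation.
    obtain ⟨_, ⟨n, e, he, rfl⟩, hlt⟩ := exists_lt_of_lt_csSup hA0
      (sub_lt_self (sSup A) (by positivity : 0 < (ε / 2) ^ 2))
    let V := Submodule.span ℝ (Set.range e)
    have : FiniteDimensional ℝ V := FiniteDimensional.span_of_finite ℝ (Set.finite_range e)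
    refine ⟨T ∘L V.starProjection, ?_, ?_⟩
    · exact ((isCompactOperator_of_locallyCompactSpace_dom V.orthogonalProjectionOnto).clm_comp
          (T ∘L V.subtypeL))
    · rw [dist_eq_norm]
      refine lt_of_le_of_lt (ContinuousLinearMap.opNorm_le_bound _ (by positivity : 0 ≤ ε / 2)
        fun f => ?_) (half_lt_self hε)
      set g := f - V.starProjection f with hg
      have hgV : g ∈ Vᗮ := V.sub_starProjection_mem_orthogonal f
      have hgf : ‖g‖ ≤ ‖f‖ := by
        have h := ContinuousLinearMap.le_of_opNorm_le _ (Vᗮ).starProjection_norm_le f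
        rwa [Submodule.starProjection_orthogonal_val, one_mul] at h
      have hTg : (T - T ∘L V.starProjection) f = T g := by simp [hg]
      rw [hTg]
      refine le_trans ?_ (mul_le_mul_of_nonneg_left hgf (by positivity))
      rcases eq_or_ne g 0 with h0 | h0
      · simp [h0]
      have hn : ‖g‖ ≠ 0 := norm_ne_zero_iff.2 h0
      have he' : Orthonormal ℝ (Fin.cons ((‖g‖)⁻¹ • g) e : Fin (n + 1) → H) := by
        refine orthonormal_vecCons_iff.2 ⟨by simp [norm_smul, hn], fun i => ?_, he⟩
        rw [inner_smul_left, Submodule.inner_left_of_mem_orthogonal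
          (Submodule.subset_span (Set.mem_range_self i)) hgV, mul_zero]
      have h1 := le_csSup hA1 ⟨n + 1, _, he', rfl⟩
      rw [Fin.sum_univ_succ] at h1
      simp only [Fin.cons_zero, Fin.cons_succ, map_smul, norm_smul, norm_inv, norm_norm] at h1
      have h2 : (‖g‖⁻¹ * ‖T g‖) ^ 2 < (ε / 2) ^ 2 := by linarith
      have h3 := lt_of_pow_lt_pow_left₀ 2 (by positivity) h2
      rw [inv_mul_lt_iff₀ (by positivity)] at h3
      linarith
  rwa [isClosed_setOfPred_isCompactOperator.closure_eq] at key

namespace IsBoundedFeature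

variable {𝒳 : Type*} [MeasurableSpace 𝒳] {H : Type*} [NormedAddCommGroup H]
  [InnerProductSpace ℝ H]
variable {Ψ : 𝒳 → H} {B : ℝ} (hΨ : IsBoundedFeature Ψ B)
  (P : Measure 𝒳) [IsProbabilityMeasure P]

include hΨ

variable [CompleteSpace H]

/-- The integral operator on `L²` with kernel `⟪Ψ x, Ψ y⟫`. -/
def gramOp : Lp ℝ 2 P →L[ℝ] Lp ℝ 2 P :=
  hΨ.toL2 P ∘L ContinuousLinearMap.adjoint (hΨ.toL2 P)

theorem inner_adjoint_toL2 (u : Lp ℝ 2 P) (x : 𝒳) :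
    inner ℝ (ContinuousLinearMap.adjoint (hΨ.toL2 P) u) (Ψ x) =
      ∫ y, inner ℝ (Ψ x) (Ψ y) * u y ∂P := by
  rw [ContinuousLinearMap.adjoint_inner_left, real_inner_comm, inner_toL2]

theorem gramOp_ae (u : Lp ℝ 2 P) :
    hΨ.gramOp P u =ᵐ[P] fun x => ∫ y, inner ℝ (Ψ x) (Ψ y) * u y ∂P := by
  filter_upwards [hΨ.coeFn_toL2 P (ContinuousLinearMap.adjoint (hΨ.toL2 P) u)] with x hx
  rw [← inner_adjoint_toL2]
  exact hx

/-- Boundedness of `Ψ` makes the integrability clause automatic, so the pointwise equation is the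
eigenvalue equation in `L²`. This brings the multiplicities counted in `IsEigenvalueSeq` under the
spectral theorem. -/
theorem integralEigenspace_eq (c : ℝ) :
    integralEigenspace (fun x y => inner ℝ (Ψ x) (Ψ y)) P c =
      Module.End.eigenspace (hΨ.gramOp P : Module.End ℝ (Lp ℝ 2 P)) c := by
  ext u
  rw [Module.End.mem_eigenspace_iff]
  have hint : ∀ x, Integrable (fun y => inner ℝ (Ψ x) (Ψ y) * u y) P := fun x =>
    (hΨ.memLp P (Ψ x)).integrable_mul (Lp.memLp u)
  change (∀ᵐ x ∂P, _) ↔ hΨ.gramOp P u = c • u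
  rw [Lp.ext_iff]
  constructor
  · intro h
    filter_upwards [h, hΨ.gramOp_ae P u, Lp.coeFn_smul c u] with x h1 h2 h3
    rw [h2, h3, h1.2]; simp
  · intro h
    filter_upwards [h, hΨ.gramOp_ae P u, Lp.coeFn_smul c u] with x h1 h2 h3
    refine ⟨hint x, ?_⟩
    rw [← h2, h1, h3]; simp

theorem isCompactOperator_gramOp : IsCompactOperator (hΨ.gramOp P) :=
  (isCompactOperator_of_sum_norm_sq_le (hΨ.toL2 P) fun _ _ he =>
    hΨ.sum_norm_toL2_sq_le P he _).comp_clm _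

theorem isSymmetric_gramOp : (hΨ.gramOp P : Lp ℝ 2 P →ₗ[ℝ] Lp ℝ 2 P).IsSymmetric := fun u v => by
  change inner ℝ (hΨ.toL2 P (ContinuousLinearMap.adjoint (hΨ.toL2 P) u)) v =
    inner ℝ u (hΨ.toL2 P (ContinuousLinearMap.adjoint (hΨ.toL2 P) v))
  rw [← ContinuousLinearMap.adjoint_inner_right, ContinuousLinearMap.adjoint_inner_left]

theorem inner_gramOp_right (u v : Lp ℝ 2 P) :
    inner ℝ u (hΨ.gramOp P v) = inner ℝ (ContinuousLinearMap.adjoint (hΨ.toL2 P) u)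
      (ContinuousLinearMap.adjoint (hΨ.toL2 P) v) := by
  rw [ContinuousLinearMap.adjoint_inner_left, gramOp, ContinuousLinearMap.comp_apply]

/-- If `T T* z = 0` then `‖T* z‖² = ⟪z, T T* z⟫ = 0`, so `z` is orthogonal to the range of `T`.
Consequently every `T f` is expanded by the eigenvectors for nonzero eigenvalues alone. -/
theorem toL2_mem_orthogonal_ker (f : H) :
    hΨ.toL2 P f ∈ (Module.End.eigenspace (hΨ.gramOp P : Module.End ℝ (Lp ℝ 2 P)) 0)ᗮ := by
  rw [Submodule.mem_orthogonal]
  intro z hz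
  have hz' : hΨ.gramOp P z = 0 := by simpa [Module.End.mem_eigenspace_iff] using hz
  have h := hΨ.inner_gramOp_right P z z
  rw [hz', inner_zero_right, eq_comm, inner_self_eq_zero] at h
  rw [← ContinuousLinearMap.adjoint_inner_left, h, inner_zero_left]

end IsBoundedFeature

/-! ### Eigenvectors for an enumeration of the eigenvalues -/

section SpectralFamily

/-- Pythagoras for the projection onto a finite orthonormal family. It supplies the dominating
constant for the Mercer expansion. -/
theorem norm_sub_sum_inner_le {E ι : Type*} [NormedAddCommGroup E] [InnerProductSpace ℝ E]
    {u : ι → E} (hu : Orthonormal ℝ u) (w : E) (s : Finset ι) :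
    ‖w - ∑ p ∈ s, inner ℝ (u p) w • u p‖ ≤ ‖w‖ := by
  refine le_of_sq_le_sq ?_ (norm_nonneg w)
  rw [norm_sub_sq_real, ← real_inner_self_eq_norm_sq (∑ p ∈ s, _), hu.inner_sum]
  simp only [inner_sum, inner_smul_right, real_inner_comm, conj_trivial]
  nlinarith [Finset.sum_nonneg fun p (_ : p ∈ s) => mul_self_nonneg (inner ℝ w (u p))]

variable {E : Type*} [NormedAddCommGroup E] [InnerProductSpace ℝ E] [CompleteSpace E]

/-- An enumeration of the nonzero eigenvalues of a compact symmetric operator, counted with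
multiplicity, comes with an orthonormal family of eigenvectors that spans the orthogonal complement
of the kernel. -/
theorem exists_orthonormal_eigenvectors {S : E →L[ℝ] E} (hS : IsCompactOperator S)
    (hsymm : (S : E →ₗ[ℝ] E).IsSymmetric) {lam : ℕ → ℝ}
    (hlam : ∀ c : ℝ, c ≠ 0 → {p : ℕ | lam p = c}.encard =
      Cardinal.toENat (Module.rank ℝ (Module.End.eigenspace (S : Module.End ℝ E) c))) :
    ∃ u : {p : ℕ // lam p ≠ 0} → E, Orthonormal ℝ u ∧ (∀ p, S (u p) = lam p • u p) ∧
      ∀ w ∈ (Module.End.eigenspace (S : Module.End ℝ E) 0)ᗮ,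
        HasSum (fun p => inner ℝ (u p) w • u p) w := by
  have hv : ∀ c : ℝ, c ≠ 0 → ∃ v : {p : ℕ // lam p = c} →
      Module.End.eigenspace (S : Module.End ℝ E) c,
      Orthonormal ℝ v ∧ Submodule.span ℝ (Set.range v) = ⊤ := by
    intro c hc
    have hfin : FiniteDimensional ℝ (Module.End.eigenspace (S : Module.End ℝ E) c) :=
      ContinuousLinearMap.finite_dimensional_eigenspace hS c hc
    have h := hlam c hc
    rw [← Module.finrank_eq_rank, Cardinal.toENat_nat] at h
    have hf : {p : ℕ | lam p = c}.Finite := Set.finite_of_encard_eq_coe h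
    have : Finite {p : ℕ // lam p = c} := hf
    have hcard : Nat.card {p : ℕ // lam p = c} =
        Module.finrank ℝ (Module.End.eigenspace (S : Module.End ℝ E) c) := by
      change Set.ncard {p : ℕ | lam p = c} = _
      rw [Set.ncard, h, ENat.toNat_natCast]
    let e := Finite.equivFinOfCardEq hcard
    let b := stdOrthonormalBasis ℝ (Module.End.eigenspace (S : Module.End ℝ E) c)
    refine ⟨b ∘ e, b.orthonormal.comp _ e.injective, ?_⟩
    rw [e.surjective.range_comp, ← b.coe_toBasis, b.toBasis.span_eq]
  choose v hv1 hv2 using hv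
  let u : {p : ℕ // lam p ≠ 0} → E := fun p => v (lam p) p.2 ⟨p, rfl⟩
  -- The basis used for `u p` depends on `lam p`. Transport along `lam p = c` allows two indices
  -- with equal eigenvalues to be compared inside one basis.
  have huv : ∀ (c : ℝ) (hc : c ≠ 0) (p : {p : ℕ // lam p ≠ 0}) (h : lam p = c),
      u p = v c hc ⟨p, h⟩ := by
    rintro c hc p rfl; rfl
  have heig : ∀ p : {p : ℕ // lam p ≠ 0}, u p ∈ Module.End.eigenspace (S : Module.End ℝ E) (lam p) := fun p =>
    (v (lam p) p.2 ⟨p, rfl⟩).2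
  have horth : Orthonormal ℝ u := by
    refine ⟨fun p => (hv1 (lam p) p.2).1 _, fun p q hpq => ?_⟩
    by_cases h : lam p = lam q
    · change inner ℝ (u p) (u q) = 0
      rw [huv _ q.2 p h, huv _ q.2 q rfl]
      exact (hv1 (lam q) q.2).2 fun hh => hpq (Subtype.ext (by simpa using hh))
    · exact hsymm.orthogonalFamily_eigenspaces h ⟨u p, heig p⟩ ⟨u q, heig q⟩
  refine ⟨u, horth, fun p => Module.End.mem_eigenspace_iff.1 (heig p), ?_⟩
  have hu0 : ∀ p, u p ∈ (Module.End.eigenspace (S : Module.End ℝ E) 0)ᗮ := fun p => by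
    rw [Submodule.mem_orthogonal]
    intro z hz
    exact hsymm.orthogonalFamily_eigenspaces p.2.symm ⟨z, hz⟩ ⟨u p, heig p⟩
  let K := (Module.End.eigenspace (S : Module.End ℝ E) 0)ᗮ
  let u' : {p : ℕ // lam p ≠ 0} → K := fun p => ⟨u p, hu0 p⟩
  have horth' : Orthonormal ℝ u' := ⟨fun p => horth.1 p, fun p q hpq => horth.2 hpq⟩
  -- A vector of `K` orthogonal to all `u p` is orthogonal to every eigenspace, including the one
  -- for `0`. For a compact symmetric operator only the zero vector has this property.
  have hbot : (Submodule.span ℝ (Set.range u'))ᗮ = ⊥ := by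
    rw [Submodule.eq_bot_iff]
    intro z hz
    have hzu : ∀ p, inner ℝ (u p) (z : E) = 0 := fun p =>
      (Submodule.mem_orthogonal _ z).1 hz _ (Submodule.subset_span (Set.mem_range_self p))
    have hz0 : (z : E) ∈ (⨆ c, Module.End.eigenspace (S : Module.End ℝ E) c)ᗮ := by
      rw [← Submodule.iInf_orthogonal, Submodule.mem_iInf]
      intro c
      rcases eq_or_ne c 0 with rfl | hc
      · exact z.2
      · rw [Submodule.mem_orthogonal]
        intro w hw
        have hle : Submodule.span ℝ (Set.range (v c hc)) ≤
            (ℝ ∙ (z : E))ᗮ.comap (Submodule.subtype _) := by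
          rw [Submodule.span_le]
          rintro _ ⟨⟨p, rfl⟩, rfl⟩
          rw [SetLike.mem_coe, Submodule.mem_comap, Submodule.mem_orthogonal_singleton_iff_inner_left]
          exact hzu ⟨p, hc⟩
        rw [hv2] at hle
        exact Submodule.mem_orthogonal_singleton_iff_inner_left.1
          (hle (Submodule.mem_top : (⟨w, hw⟩ : Module.End.eigenspace (S : Module.End ℝ E) c) ∈ _))
    rw [ContinuousLinearMap.orthogonalComplement_iSup_eigenspaces_eq_bot hS hsymm,
      Submodule.mem_bot] at hz0
    exact Subtype.ext hz0
  intro w hw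
  have h := (HilbertBasis.mkOfOrthogonalEqBot horth' hbot).hasSum_repr ⟨w, hw⟩
  simp only [HilbertBasis.repr_apply_apply, HilbertBasis.coe_mkOfOrthogonalEqBot] at h
  exact h.mapL K.subtypeL

end SpectralFamily

/-! ### Trace class property and Mercer expansion -/

namespace IsBoundedFeature

variable {𝒳 : Type*} [MeasurableSpace 𝒳] {H : Type*} [NormedAddCommGroup H]
  [InnerProductSpace ℝ H] [CompleteSpace H]
variable {Ψ : 𝒳 → H} {B : ℝ} (hΨ : IsBoundedFeature Ψ B)
  (P : Measure 𝒳) [IsProbabilityMeasure P]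

include hΨ

omit [CompleteSpace H] in
theorem inner_toL2_toL2 (f g : H) :
    inner ℝ (hΨ.toL2 P f) (hΨ.toL2 P g) = ∫ x, inner ℝ f (Ψ x) * inner ℝ g (Ψ x) ∂P := by
  rw [inner_toL2]
  refine integral_congr_ae ?_
  filter_upwards [hΨ.coeFn_toL2 P g] with x hx
  rw [hx]

/-- The eigenvalues of the integral operator are summable: the operator is of trace class. -/
theorem summable_eigenvalues {lam : ℕ → ℝ} {u : {p : ℕ // lam p ≠ 0} → Lp ℝ 2 P}
    (hu : Orthonormal ℝ u) (heig : ∀ p, hΨ.gramOp P (u p) = lam p • u p) : Summable lam := by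
  let a : {p : ℕ // lam p ≠ 0} → H := fun p => ContinuousLinearMap.adjoint (hΨ.toL2 P) (u p)
  have hTa : ∀ p, hΨ.toL2 P (a p) = lam p • u p := heig
  have ha : ∀ p q, inner ℝ (a p) (a q) = lam q * inner ℝ (u p) (u q) := fun p q => by
    rw [← hΨ.inner_gramOp_right P, heig, inner_smul_right]
  have hpos : ∀ p : {p : ℕ // lam p ≠ 0}, 0 < lam p := fun p => by
    have h := ha p p
    rw [real_inner_self_eq_norm_sq, real_inner_self_eq_norm_sq, hu.1 p, one_pow, mul_one] at h
    exact lt_of_le_of_ne (h ▸ sq_nonneg _) p.2.symm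
  -- The vectors `λ_p^{-1/2} T* u_p` are orthonormal in `H`, and `T` sends them to `√λ_p u_p`. The
  -- Hilbert–Schmidt bound for this family therefore reads `∑ λ_p ≤ B²`.
  have he : Orthonormal ℝ fun p : {p : ℕ // lam p ≠ 0} => (√(lam p))⁻¹ • a p := by
    refine ⟨fun p => ?_, fun p q hpq => ?_⟩
    · have h := ha p p
      rw [real_inner_self_eq_norm_sq, real_inner_self_eq_norm_sq, hu.1 p, one_pow, mul_one] at h
      rw [norm_smul, ← h, Real.sqrt_sq (norm_nonneg _), norm_inv, norm_norm, inv_mul_cancel₀]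
      intro h0
      rw [h0] at h
      exact (hpos p).ne (by simpa using h)
    · change inner ℝ ((√(lam p))⁻¹ • a p) ((√(lam q))⁻¹ • a q) = 0
      rw [inner_smul_left, inner_smul_right, ha, hu.2 hpq]
      simp
  have hle : ∀ s : Finset {p : ℕ // lam p ≠ 0}, ∑ p ∈ s, lam p ≤ B ^ 2 := fun s => by
    refine le_trans (le_of_eq (Finset.sum_congr rfl fun p _ => ?_)) (hΨ.sum_norm_toL2_sq_le P he s)
    rw [map_smul, hTa, norm_smul, norm_smul, hu.1 p, mul_one, mul_pow, norm_inv, inv_pow,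
      Real.norm_eq_abs, Real.norm_eq_abs, sq_abs, sq_abs, Real.sq_sqrt (hpos p).le]
    field_simp
  have hs : Summable fun p : {p : ℕ // lam p ≠ 0} => lam p :=
    summable_of_sum_le (fun p => (hpos p).le) hle
  exact (Function.Injective.summable_iff Subtype.val_injective fun p hp => by
    by_contra h; exact hp ⟨⟨p, h⟩, rfl⟩).1 hs

/-- Mercer expansion, in the sense of `L²(P ⊗ P)`, for the eigenvalues `lam`. -/
theorem exists_eigenfunctions {lam : ℕ → ℝ}
    (hlam : IsEigenvalueSeq (fun x y => inner ℝ (Ψ x) (Ψ y)) P lam) :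
    ∃ g : ℕ → H, Summable lam ∧
      (∀ p q, ∫ x, inner ℝ (g p) (Ψ x) * inner ℝ (g q) (Ψ x) ∂P =
        if p = q ∧ lam p ≠ 0 then 1 else 0) ∧
      Tendsto (fun N : ℕ => ∫ z, (inner ℝ (Ψ z.1) (Ψ z.2) - ∑ p ∈ Finset.range N,
        lam p * inner ℝ (g p) (Ψ z.1) * inner ℝ (g p) (Ψ z.2)) ^ 2 ∂(P.prod P)) atTop (𝓝 0) := by
  have hlam' : ∀ c : ℝ, c ≠ 0 → {p : ℕ | lam p = c}.encard = Cardinal.toENat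
      (Module.rank ℝ (Module.End.eigenspace (hΨ.gramOp P : Module.End ℝ (Lp ℝ 2 P)) c)) :=
    fun c hc => by
      rw [← hΨ.integralEigenspace_eq P]
      exact hlam c hc
  obtain ⟨u, hu, heig, hsum⟩ := exists_orthonormal_eigenvectors (hΨ.isCompactOperator_gramOp P)
    (hΨ.isSymmetric_gramOp P) hlam'
  -- Since `T (λ_p⁻¹ T* u_p) = u_p`, this element of `H` gives a representative of the eigenfunction
  -- that is defined everywhere and bounded. At `lam p = 0` the value `0` is harmless, as the term
  -- carries the factor `lam p`.
  let g : ℕ → H := fun p => if h : lam p ≠ 0 then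
    (lam p)⁻¹ • ContinuousLinearMap.adjoint (hΨ.toL2 P) (u ⟨p, h⟩) else 0
  have hg0 : ∀ p, lam p = 0 → g p = 0 := fun p h => by simp [g, h]
  have hg : ∀ p : {p : ℕ // lam p ≠ 0},
      g p = (lam p)⁻¹ • ContinuousLinearMap.adjoint (hΨ.toL2 P) (u p) := fun p => by
    simp [g, p.2]
  have hTg : ∀ p : {p : ℕ // lam p ≠ 0}, hΨ.toL2 P (g p) = u p := fun p => by
    rw [hg, map_smul]
    change (lam p)⁻¹ • hΨ.gramOp P (u p) = _
    rw [heig, smul_smul, inv_mul_cancel₀ p.2, one_smul]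
  have hcoef : ∀ (p : {p : ℕ // lam p ≠ 0}) x,
      inner ℝ (u p) (hΨ.toL2 P (Ψ x)) = lam p * inner ℝ (g p) (Ψ x) := fun p x => by
    rw [hg, inner_smul_left, ContinuousLinearMap.adjoint_inner_left]
    simp [p.2]
  refine ⟨g, hΨ.summable_eigenvalues P hu heig, fun p q => ?_, ?_⟩
  · rw [← hΨ.inner_toL2_toL2 P]
    by_cases hp : lam p = 0
    · simp [hg0 p hp, hp]
    by_cases hq : lam q = 0
    · have : p ≠ q := fun h => hp (h ▸ hq)
      simp [hg0 q hq, this]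
    rw [hTg ⟨p, hp⟩, hTg ⟨q, hq⟩, orthonormal_iff_ite.1 hu]
    simp [hp]
  have hexp : ∀ x, HasSum (fun p : ℕ => (lam p * inner ℝ (g p) (Ψ x)) • hΨ.toL2 P (g p))
      (hΨ.toL2 P (Ψ x)) := fun x => by
    have h := hsum _ (hΨ.toL2_mem_orthogonal_ker P (Ψ x))
    refine (Function.Injective.hasSum_iff Subtype.val_injective fun p hp => ?_).1
      (h.congr_fun ?_)
    · have hp0 : lam p = 0 := by by_contra h0; exact hp ⟨⟨p, h0⟩, rfl⟩
      simp [hp0]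
    · intro p
      simp only [Function.comp_apply]
      rw [hcoef, hTg]
  -- For fixed `x`, the squared `L²` norm in `y` of the Mercer remainder is `‖T (r N x)‖²`. It tends
  -- to `0` by the eigenvector expansion of `T (Ψ x)` and is at most `(B * B) ^ 2`, so dominated
  -- convergence in `x` finishes the proof.
  let r : ℕ → 𝒳 → H := fun N x =>
    Ψ x - ∑ p ∈ Finset.range N, (lam p * inner ℝ (g p) (Ψ x)) • g p
  have hr : ∀ N x, ∫ y, (inner ℝ (Ψ x) (Ψ y) - ∑ p ∈ Finset.range N,
      lam p * inner ℝ (g p) (Ψ x) * inner ℝ (g p) (Ψ y)) ^ 2 ∂P = ‖hΨ.toL2 P (r N x)‖ ^ 2 := by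
    intro N x
    rw [norm_toL2_sq]
    simp [r, inner_sub_left, sum_inner, inner_smul_left]
  have hTr : ∀ N x, hΨ.toL2 P (r N x) = hΨ.toL2 P (Ψ x) -
      ∑ p ∈ Finset.range N, (lam p * inner ℝ (g p) (Ψ x)) • hΨ.toL2 P (g p) := fun N x => by
    simp [r]
  have hlim : ∀ x, Tendsto (fun N => ‖hΨ.toL2 P (r N x)‖ ^ 2) atTop (𝓝 0) := fun x => by
    have h := ((hexp x).tendsto_sum_nat.const_sub (hΨ.toL2 P (Ψ x))).norm.pow 2
    simpa [hTr] using h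
  have hbd : ∀ N x, ‖hΨ.toL2 P (r N x)‖ ≤ B * B := fun N x => by
    have h := norm_sub_sum_inner_le hu (hΨ.toL2 P (Ψ x))
      ((Finset.range N).subtype fun p => lam p ≠ 0)
    have h1 : ∑ p ∈ (Finset.range N).subtype (fun p => lam p ≠ 0),
        inner ℝ (u p) (hΨ.toL2 P (Ψ x)) • u p =
        ∑ p ∈ Finset.range N, (lam p * inner ℝ (g p) (Ψ x)) • hΨ.toL2 P (g p) := by
      simp only [hcoef]
      simp only [← hTg]
      rw [Finset.sum_subtype_eq_sum_filter (s := Finset.range N) (p := fun p => lam p ≠ 0)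
        fun p => (lam p * inner ℝ (g p) (Ψ x)) • hΨ.toL2 P (g p)]
      refine Finset.sum_filter_of_ne fun p _ hp h0 => hp (by simp [h0])
    rw [h1, ← hTr] at h
    have hB : 0 ≤ B := (norm_nonneg _).trans (hΨ.norm_le x)
    exact h.trans ((hΨ.norm_toL2_le P _).trans (mul_le_mul_of_nonneg_left (hΨ.norm_le x) hB))
  have hmeas : ∀ N, Measurable fun z : 𝒳 × 𝒳 => (inner ℝ (Ψ z.1) (Ψ z.2) -
      ∑ p ∈ Finset.range N, lam p * inner ℝ (g p) (Ψ z.1) * inner ℝ (g p) (Ψ z.2)) ^ 2 := by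
    intro N
    have h1 := hΨ.measurable_gram
    have h2 : ∀ p, Measurable fun x => inner ℝ (g p) (Ψ x) := fun p => hΨ.measurable_inner _
    refine (h1.sub (Finset.measurable_sum _ fun p _ => ?_)).pow_const 2
    exact (((h2 p).comp measurable_fst).const_mul _).mul ((h2 p).comp measurable_snd)
  have hint : ∀ N, Integrable (fun z : 𝒳 × 𝒳 => (inner ℝ (Ψ z.1) (Ψ z.2) -
      ∑ p ∈ Finset.range N, lam p * inner ℝ (g p) (Ψ z.1) * inner ℝ (g p) (Ψ z.2)) ^ 2)
      (P.prod P) := by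
    intro N
    refine Integrable.of_bound (hmeas N).aestronglyMeasurable
      ((B * B + ∑ p ∈ Finset.range N, |lam p| * (B * ‖g p‖) * (B * ‖g p‖)) ^ 2)
      (ae_of_all _ fun z => ?_)
    rw [norm_pow]
    refine pow_le_pow_left₀ (norm_nonneg _) ((norm_sub_le _ _).trans (add_le_add ?_ ?_)) 2
    · have hB : 0 ≤ B := (norm_nonneg _).trans (hΨ.norm_le z.1)
      exact (hΨ.abs_inner_le _ _).trans (mul_le_mul_of_nonneg_left (hΨ.norm_le _) hB)
    · refine (norm_sum_le _ _).trans (Finset.sum_le_sum fun p _ => ?_)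
      have h1 := hΨ.abs_inner_le (g p) z.1
      have h2 := hΨ.abs_inner_le (g p) z.2
      rw [norm_mul, norm_mul, Real.norm_eq_abs (lam p)]
      gcongr
      exact mul_nonneg (abs_nonneg _) ((norm_nonneg _).trans h1)
  have hiter : ∀ N, ∫ z, (inner ℝ (Ψ z.1) (Ψ z.2) - ∑ p ∈ Finset.range N,
      lam p * inner ℝ (g p) (Ψ z.1) * inner ℝ (g p) (Ψ z.2)) ^ 2 ∂(P.prod P) =
      ∫ x, ‖hΨ.toL2 P (r N x)‖ ^ 2 ∂P := fun N => by
    rw [integral_prod _ (hint N)]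
    simp only [hr]
  simp only [hiter]
  have hdct := tendsto_integral_of_dominated_convergence
    (F := fun N x => ‖hΨ.toL2 P (r N x)‖ ^ 2) (f := fun _ => 0) (μ := P) (fun _ => (B * B) ^ 2)
    (fun N => by
      simp only [← hr]
      exact (hmeas N).stronglyMeasurable.integral_prod_right.aestronglyMeasurable)
    (integrable_const _) (fun N => ae_of_all _ fun x => by
      rw [Real.norm_eq_abs, abs_of_nonneg (sq_nonneg _)]
      exact pow_le_pow_left₀ (norm_nonneg _) (hbd N x) 2) (ae_of_all _ hlim)
  simpa using hdct

end IsBoundedFeature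

/-! ### Second moments of degenerate kernels -/

section DegenerateKernel

variable {𝒳 : Type*} [MeasurableSpace 𝒳]

/-- A bounded measurable symmetric kernel with `∫ h(x, ·) dP = 0` for all `x`. -/
structure IsDegenerateKernel (h : 𝒳 → 𝒳 → ℝ) (P : Measure 𝒳) : Prop where
  measurable : Measurable fun z : 𝒳 × 𝒳 => h z.1 z.2
  bounded : ∃ C, ∀ x y, ‖h x y‖ ≤ C
  symm : ∀ x y, h x y = h y x
  integral_eq_zero : ∀ x, ∫ y, h x y ∂P = 0

namespace IsDegenerateKernel

variable {h : 𝒳 → 𝒳 → ℝ} {P : Measure 𝒳} (hh : IsDegenerateKernel h P)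
  {Ω : Type*} [MeasurableSpace Ω] {μ : Measure Ω} [IsProbabilityMeasure μ]
  {I : Type*} {ξ : I → Ω → 𝒳}

include hh

theorem measurable_comp (hξ : ∀ a, Measurable (ξ a)) (a b : I) :
    Measurable fun ω => h (ξ a ω) (ξ b ω) :=
  hh.measurable.comp ((hξ a).prodMk (hξ b))

theorem integrable_mul (hξ : ∀ a, Measurable (ξ a)) (a b c d : I) :
    Integrable (fun ω => h (ξ a ω) (ξ b ω) * h (ξ c ω) (ξ d ω)) μ := by
  obtain ⟨C, hC⟩ := hh.bounded
  refine Integrable.of_bound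
    ((hh.measurable_comp hξ a b).mul (hh.measurable_comp hξ c d)).aestronglyMeasurable (C * C)
    (ae_of_all _ fun ω => ?_)
  rw [norm_mul]
  exact mul_le_mul (hC _ _) (hC _ _) (norm_nonneg _) ((norm_nonneg _).trans (hC (ξ a ω) (ξ b ω)))

variable (hξ : ∀ a, Measurable (ξ a)) (hlaw : ∀ a, μ.map (ξ a) = P) (hind : iIndepFun ξ μ)

include hξ hlaw hind

/-- The point `ξ a` is independent of the block formed by `ξ b`, `ξ c`, `ξ d`, whether or not these
indices are distinct. Integrating over `ξ a` first gives `0` by degeneracy. -/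
theorem integral_mul_eq_zero {a b c d : I} (hab : a ≠ b) (hac : a ≠ c) (had : a ≠ d) :
    ∫ ω, h (ξ a ω) (ξ b ω) * h (ξ c ω) (ξ d ω) ∂μ = 0 := by
  have hP : IsProbabilityMeasure P := hlaw a ▸ Measure.isProbabilityMeasure_map (hξ a).aemeasurable
  classical
  let S : Finset I := {b, c, d}
  let η : Ω → S → 𝒳 := fun ω i => ξ i ω
  have hη : Measurable η := measurable_pi_lambda _ fun i => hξ i
  let b' : S := ⟨b, by simp [S]⟩
  let c' : S := ⟨c, by simp [S]⟩
  let d' : S := ⟨d, by simp [S]⟩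
  have hi : IndepFun η (ξ a) μ := by
    have h1 := hind.indepFun_finset S {a} (by simp [S, hab, hac, had]) hξ
    exact h1.comp (ψ := fun (f : ({a} : Finset I) → 𝒳) => f ⟨a, by simp⟩) measurable_id
      (measurable_pi_apply _)
  have hmap := (indepFun_iff_map_prod_eq_prod_map_map hη.aemeasurable (hξ a).aemeasurable).1 hi
  rw [hlaw a] at hmap
  let F : (S → 𝒳) × 𝒳 → ℝ := fun z => h z.2 (z.1 b') * h (z.1 c') (z.1 d')
  have hF : Measurable F := by
    have e : ∀ i : S, Measurable fun z : (S → 𝒳) × 𝒳 => z.1 i := fun i =>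
      (measurable_pi_apply i).comp measurable_fst
    exact (hh.measurable.comp (measurable_snd.prodMk (e b'))).mul
      (hh.measurable.comp ((e c').prodMk (e d')))
  have hpη : IsProbabilityMeasure (μ.map η) := Measure.isProbabilityMeasure_map hη.aemeasurable
  have hFint : Integrable F ((μ.map η).prod P) := by
    rw [← hmap, integrable_map_measure hF.aestronglyMeasurable (hη.prodMk (hξ a)).aemeasurable]
    exact hh.integrable_mul hξ a b c d
  calc ∫ ω, h (ξ a ω) (ξ b ω) * h (ξ c ω) (ξ d ω) ∂μ
      = ∫ z, F z ∂(μ.map fun ω => (η ω, ξ a ω)) :=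
        (integral_map (hη.prodMk (hξ a)).aemeasurable hF.aestronglyMeasurable).symm
    _ = ∫ y, ∫ x, F (y, x) ∂P ∂(μ.map η) := by rw [hmap, integral_prod _ hFint]
    _ = 0 := by
        refine integral_eq_zero_of_ae (ae_of_all _ fun y => ?_)
        change ∫ x, h x (y b') * h (y c') (y d') ∂P = 0
        rw [integral_mul_const]
        simp_rw [hh.symm _ (y b')]
        rw [hh.integral_eq_zero, zero_mul]

theorem integral_sq_eq {a b : I} (hab : a ≠ b) :
    ∫ ω, h (ξ a ω) (ξ b ω) * h (ξ a ω) (ξ b ω) ∂μ = ∫ z, h z.1 z.2 ^ 2 ∂(P.prod P) := by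
  have hmap := (indepFun_iff_map_prod_eq_prod_map_map (hξ a).aemeasurable
    (hξ b).aemeasurable).1 (hind.indepFun hab)
  rw [hlaw a, hlaw b] at hmap
  rw [← hmap, integral_map ((hξ a).prodMk (hξ b)).aemeasurable
    (hh.measurable.pow_const 2).aestronglyMeasurable]
  simp only [sq]

/-- If the unordered pairs `{a, b}` and `{c, d}` differ, then `a` or `b` lies outside `{c, d}`, and
integrating over that point gives `0`. If they coincide, symmetry of `h` leaves the second moment.
-/
theorem integral_mul_le [DecidableEq I] {a b c d : I} (hab : a ≠ b) (hcd : c ≠ d) :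
    ∫ ω, h (ξ a ω) (ξ b ω) * h (ξ c ω) (ξ d ω) ∂μ ≤
      if (c, d) ∈ ({(a, b), (b, a)} : Finset (I × I)) then ∫ z, h z.1 z.2 ^ 2 ∂(P.prod P)
      else 0 := by
  simp only [Finset.mem_insert, Finset.mem_singleton, Prod.mk.injEq]
  split_ifs with hif
  · rcases hif with ⟨rfl, rfl⟩ | ⟨rfl, rfl⟩
    · exact (hh.integral_sq_eq hξ hlaw hind hab).le
    · simp_rw [hh.symm (ξ c _) (ξ d _)]
      exact (hh.integral_sq_eq hξ hlaw hind hab).le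
  · by_cases ha : a ≠ c ∧ a ≠ d
    · exact (hh.integral_mul_eq_zero hξ hlaw hind hab ha.1 ha.2).le
    · have hb : b ≠ c ∧ b ≠ d := by
        constructor <;> rintro rfl <;> grind
      simp_rw [hh.symm (ξ a _) (ξ b _)]
      exact (hh.integral_mul_eq_zero hξ hlaw hind hab.symm hb.1 hb.2).le

/-- Second moment of a sum of a degenerate kernel over pairs of distinct sample points. -/
theorem integral_sum_sq_le (s : Finset (I × I)) (hs : ∀ z ∈ s, z.1 ≠ z.2) :
    ∫ ω, (∑ z ∈ s, h (ξ z.1 ω) (ξ z.2 ω)) ^ 2 ∂μ ≤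
      2 * s.card * ∫ z, h z.1 z.2 ^ 2 ∂(P.prod P) := by
  classical
  set V := ∫ z, h z.1 z.2 ^ 2 ∂(P.prod P)
  have hV : 0 ≤ V := integral_nonneg fun z => sq_nonneg _
  simp_rw [sq, Finset.sum_mul_sum]
  rw [integral_finsetSum _ fun z _ => integrable_finsetSum _ fun w _ => hh.integrable_mul hξ _ _ _ _]
  have h1 : ∀ z ∈ s, ∫ ω, ∑ w ∈ s, h (ξ z.1 ω) (ξ z.2 ω) * h (ξ w.1 ω) (ξ w.2 ω) ∂μ ≤ 2 * V := by
    intro z hz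
    rw [integral_finsetSum _ fun w _ => hh.integrable_mul hξ _ _ _ _]
    calc _ ≤ ∑ w ∈ s, if (w.1, w.2) ∈ ({(z.1, z.2), (z.2, z.1)} : Finset (I × I)) then V else 0 :=
          Finset.sum_le_sum fun w hw => hh.integral_mul_le hξ hlaw hind (hs z hz) (hs w hw)
      _ ≤ 2 * V := by
          -- For fixed `z`, only `z` and its reversal can contribute, whence the factor `2`.
          rw [← Finset.sum_filter, Finset.sum_const, nsmul_eq_mul]
          refine mul_le_mul_of_nonneg_right ?_ hV
          have h2 : (s.filter fun w => (w.1, w.2) ∈ ({(z.1, z.2), (z.2, z.1)} : Finset (I × I))) ⊆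
              {(z.1, z.2), (z.2, z.1)} := fun w hw => (Finset.mem_filter.1 hw).2
          exact_mod_cast (Finset.card_le_card h2).trans Finset.card_le_two
  refine (Finset.sum_le_sum h1).trans (le_of_eq ?_)
  rw [Finset.sum_const, nsmul_eq_mul]
  ring

end IsDegenerateKernel

end DegenerateKernel

/-! ### Normalized sums over pairs of distinct points -/

section CrossStat

variable {𝒳 Ω : Type*} {k : ℕ}

/-- The normalized sum of a kernel over all pairs of distinct points, the first one in the sample
`j` and the second one in the sample `l`. -/
def crossStat (h : 𝒳 → 𝒳 → ℝ) (X : Fin k → ℕ → Ω → 𝒳) (n : Fin k → ℕ) (j l : Fin k) (ω : Ω) : ℝ :=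
  (√(n j))⁻¹ * (√(n l))⁻¹ * ∑ i ∈ Finset.range (n j), ∑ r ∈ Finset.range (n l),
    if (j, i) = (l, r) then 0 else h (X j i ω) (X l r ω)

variable [MeasurableSpace 𝒳] [MeasurableSpace Ω] {h : 𝒳 → 𝒳 → ℝ} {P : Measure 𝒳}
  {μ : Measure Ω} [IsProbabilityMeasure μ] {X : Fin k → ℕ → Ω → 𝒳}

theorem measurable_crossStat (hh : Measurable fun z : 𝒳 × 𝒳 => h z.1 z.2)
    (hX : ∀ j i, Measurable (X j i)) (n : Fin k → ℕ) (j l : Fin k) :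
    Measurable (crossStat h X n j l) := by
  refine Measurable.const_mul (Finset.measurable_sum _ fun i _ => Finset.measurable_sum _
    fun r _ => ?_) _
  split_ifs
  · exact measurable_const
  · exact hh.comp ((hX j i).prodMk (hX l r))

/-- At most `n j * n l` pairs enter, and the normalization divides the second moment by the same
number. The resulting bound is uniform in the sample sizes, which allows the kernel to be truncated
first. -/
theorem integral_crossStat_sq_le (hh : IsDegenerateKernel h P) (hX : ∀ j i, Measurable (X j i))
    (hlaw : ∀ j i, μ.map (X j i) = P) (hind : iIndepFun (fun q : Fin k × ℕ => X q.1 q.2) μ)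
    (n : Fin k → ℕ) (j l : Fin k) :
    ∫ ω, crossStat h X n j l ω ^ 2 ∂μ ≤ 2 * ∫ z, h z.1 z.2 ^ 2 ∂(P.prod P) := by
  let s : Finset ((Fin k × ℕ) × (Fin k × ℕ)) :=
    ((({j} : Finset (Fin k)) ×ˢ Finset.range (n j)) ×ˢ
      (({l} : Finset (Fin k)) ×ˢ Finset.range (n l))).filter fun z => z.1 ≠ z.2
  have hsum : ∀ ω, crossStat h X n j l ω = (√(n j))⁻¹ * (√(n l))⁻¹ *
      ∑ z ∈ s, h (X z.1.1 z.1.2 ω) (X z.2.1 z.2.2 ω) := fun ω => by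
    simp only [crossStat, s, Finset.sum_filter, Finset.sum_product, Finset.sum_singleton, ne_eq,
      ite_not]
  have hcard : (s.card : ℝ) ≤ n j * n l := by
    have h1 := Finset.card_filter_le ((({j} : Finset (Fin k)) ×ˢ Finset.range (n j)) ×ˢ
      (({l} : Finset (Fin k)) ×ˢ Finset.range (n l))) fun z => z.1 ≠ z.2
    simp only [Finset.card_product, Finset.card_singleton, Finset.card_range, one_mul] at h1
    exact_mod_cast h1
  have h2 := hh.integral_sum_sq_le (fun q : Fin k × ℕ => hX q.1 q.2) (fun q => hlaw q.1 q.2) hind s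
    fun z hz => (Finset.mem_filter.1 hz).2
  set V := ∫ z, h z.1 z.2 ^ 2 ∂(P.prod P)
  have hV : 0 ≤ V := integral_nonneg fun z => sq_nonneg _
  simp only [hsum, mul_pow, inv_pow, Real.sq_sqrt (Nat.cast_nonneg _)]
  rw [integral_const_mul]
  calc _ ≤ ((n j : ℝ)⁻¹ * (n l : ℝ)⁻¹) * (2 * (n j * n l) * V) := by
        refine mul_le_mul_of_nonneg_left (h2.trans ?_) (by positivity)
        gcongr
    _ = ((n j : ℝ)⁻¹ * n j) * ((n l : ℝ)⁻¹ * n l) * (2 * V) := by ring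
    _ ≤ 1 * 1 * (2 * V) := by
        -- An inequality rather than an equality, because `(n j)⁻¹ * n j` is `0` for an empty
        -- sample.
        gcongr <;> exact inv_mul_le_one
    _ = 2 * V := by ring

end CrossStat

/-! ### Central limit theorem over `k` independent samples -/

section CLT

variable {𝒳 : Type*} [MeasurableSpace 𝒳] {P : Measure 𝒳} [IsProbabilityMeasure P]

/-- With `v` the second moment, this is the unit-variance theorem for `ψ / √v`, evaluated at `√v`.
If `v = 0`, then `ψ` vanishes almost everywhere and both sides are `1`. -/
theorem tendsto_charFun_inv_sqrt_pow {ψ : 𝒳 → ℝ} (hψ : MemLp ψ 2 P) (h0 : ∫ x, ψ x ∂P = 0) :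
    Tendsto (fun n : ℕ => charFun (P.map ψ) (√n)⁻¹ ^ n) atTop
      (𝓝 (Complex.exp (-(∫ x, ψ x ^ 2 ∂P : ℝ) / 2))) := by
  set v := ∫ x, ψ x ^ 2 ∂P with hv
  have hv0 : 0 ≤ v := integral_nonneg fun x => sq_nonneg _
  rcases hv0.eq_or_lt with h | h
  · have h1 := (integral_eq_zero_iff_of_nonneg (fun x => sq_nonneg (ψ x)) hψ.integrable_sq).1
      (hv.symm.trans h.symm)
    have h2 : ψ =ᵐ[P] fun _ => (0 : ℝ) := by
      filter_upwards [h1] with x hx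
      simpa using hx
    rw [Measure.map_congr h2, ← h]
    simp
  · have hs : √v ≠ 0 := (Real.sqrt_pos.2 h).ne'
    have hX : AEMeasurable (fun x => (√v)⁻¹ * ψ x) P := hψ.1.aemeasurable.const_mul _
    have h1 := tendsto_charFun_inv_sqrt_mul_pow hX
      (by rw [integral_const_mul, h0, mul_zero])
      (by
        simp only [Pi.pow_apply, mul_pow]
        rw [integral_const_mul, ← hv, inv_pow, Real.sq_sqrt hv0, inv_mul_cancel₀ h.ne'])
      (√v)
    have h2 : ((√v : ℝ) : ℂ) ^ 2 = (v : ℝ) := by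
      rw [← Complex.ofReal_pow, Real.sq_sqrt hv0]
    rw [h2] at h1
    refine h1.congr fun n => ?_
    rw [charFun_map_mul_comp hψ.1.aemeasurable]
    congr 2
    field_simp

variable {Ω Ω' : Type*} [MeasurableSpace Ω] [MeasurableSpace Ω'] {μ : Measure Ω}
  [IsProbabilityMeasure μ] {μ' : Measure Ω'} [IsProbabilityMeasure μ'] {k : ℕ}
  {X : Fin k → ℕ → Ω → 𝒳} {ι : Type*} [Fintype ι] {φ : ι → 𝒳 → ℝ}

/-- The normalized sum `n_j^{-1/2} ∑_{i < n_j} φ_p(X^{(j)}_i)`. -/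
def normSum (φ : ι → 𝒳 → ℝ) (X : Fin k → ℕ → Ω → 𝒳) (n : Fin k → ℕ) (q : ι × Fin k) (ω : Ω) : ℝ :=
  (√(n q.2))⁻¹ * ∑ i ∈ Finset.range (n q.2), φ q.1 (X q.2 i ω)

-- The inner product with `t` is a sum over single sample points of `∑ p, t (p, j) * φ p`, suitably
-- scaled. Independence factorizes its characteristic function, with `n j` equal factors from the
-- sample `j`.
omit [IsProbabilityMeasure P] [IsProbabilityMeasure μ] in
theorem charFun_normSum (hX : ∀ j i, Measurable (X j i)) (hlaw : ∀ j i, μ.map (X j i) = P)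
    (hind : iIndepFun (fun q : Fin k × ℕ => X q.1 q.2) μ) (hφ : ∀ p, Measurable (φ p))
    (n : Fin k → ℕ) (t : EuclideanSpace ℝ (ι × Fin k)) :
    charFun (μ.map fun ω => (WithLp.toLp 2 fun q => normSum φ X n q ω :
      EuclideanSpace ℝ (ι × Fin k))) t =
      ∏ j, charFun (P.map fun x => ∑ p, t (p, j) * φ p x) (√(n j))⁻¹ ^ (n j) := by
  let ψ : Fin k → 𝒳 → ℝ := fun j x => ∑ p, t (p, j) * φ p x
  have hψ : ∀ j, Measurable (ψ j) := fun j =>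
    Finset.measurable_sum _ fun p _ => (hφ p).const_mul _
  -- The sample points in use. The range up to `∑ j, n j` is only a common bound that makes the set
  -- finite.
  let s : Finset (Fin k × ℕ) :=
    (Finset.univ ×ˢ Finset.range (∑ j, n j)).filter fun q => q.2 < n q.1
  have hs : ∀ q, q ∈ s ↔ q.1 ∈ (Finset.univ : Finset (Fin k)) ∧ q.2 ∈ Finset.range (n q.1) := by
    intro q
    have := Finset.single_le_sum (f := n) (fun _ _ => Nat.zero_le _) (Finset.mem_univ q.1)
    simp only [s, Finset.mem_filter, Finset.mem_product, Finset.mem_univ, Finset.mem_range,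
      true_and]
    omega
  let ζ : Fin k × ℕ → Ω → ℝ := fun q ω => (√(n q.1))⁻¹ * ψ q.1 (X q.1 q.2 ω)
  have hζ : ∀ q, Measurable (ζ q) := fun q => ((hψ q.1).comp (hX q.1 q.2)).const_mul _
  have hW : Measurable fun ω => (WithLp.toLp 2 fun q => normSum φ X n q ω :
      EuclideanSpace ℝ (ι × Fin k)) := by
    refine (WithLp.measurable_toLp 2 _).comp (measurable_pi_lambda _ fun q => ?_)
    exact (Finset.measurable_sum _ fun i _ => (hφ q.1).comp (hX q.2 i)).const_mul _
  have h1 : charFun (μ.map fun ω => (WithLp.toLp 2 fun q => normSum φ X n q ω :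
      EuclideanSpace ℝ (ι × Fin k))) t = charFun (μ.map fun ω => ∑ q ∈ s, ζ q ω) 1 := by
    rw [charFun_apply, charFun_apply_real, integral_map hW.aemeasurable (by fun_prop),
      integral_map (Finset.measurable_sum _ fun q _ => hζ q).aemeasurable (by fun_prop)]
    refine integral_congr_ae (ae_of_all _ fun ω => ?_)
    have h2 : inner ℝ (WithLp.toLp 2 fun q => normSum φ X n q ω :
      EuclideanSpace ℝ (ι × Fin k)) t = ∑ q ∈ s, ζ q ω := by
      rw [Finset.sum_finset_product s Finset.univ (fun j => Finset.range (n j)) hs]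
      simp only [PiLp.inner_apply, Fintype.sum_prod_type_right, ζ, ψ, normSum]
      refine Finset.sum_congr rfl fun j _ => ?_
      simp only [Finset.mul_sum, RCLike.inner_apply, conj_trivial]
      rw [Finset.sum_comm]
      refine Finset.sum_congr rfl fun i _ => Finset.sum_congr rfl fun p _ => ?_
      ring
    simp only [h2]
    simp
  rw [h1, iIndepFun.charFun_map_fun_finsetSum_eq_prod (fun q _ => (hζ q).aemeasurable)
    ((hind.comp (fun q x => (√(n q.1))⁻¹ * ψ q.1 x) fun q => (hψ q.1).const_mul _).restrict s),
    Finset.prod_apply, Finset.prod_finset_product s Finset.univ (fun j => Finset.range (n j)) hs]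
  refine Finset.prod_congr rfl fun j _ => ?_
  rw [Finset.prod_congr rfl (g := fun _ => charFun (P.map (ψ j)) (√(n j))⁻¹), Finset.prod_const,
    Finset.card_range]
  intro i _
  have h3 : μ.map (ζ (j, i)) = P.map fun x => (√(n j))⁻¹ * ψ j x := by
    rw [← hlaw j i, Measure.map_map ((hψ j).const_mul _) (hX j i)]
    rfl
  rw [h3, charFun_map_mul_comp (hψ j).aemeasurable, mul_one]

theorem charFun_gaussian_family {Y : ι → Fin k → Ω' → ℝ}
    (hYlaw : ∀ p j, HasLaw (Y p j) (gaussianReal 0 1) μ')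
    (hYind : iIndepFun (fun q : ι × Fin k => Y q.1 q.2) μ') (t : EuclideanSpace ℝ (ι × Fin k)) :
    charFun (μ'.map fun ω => (WithLp.toLp 2 fun q => Y q.1 q.2 ω :
      EuclideanSpace ℝ (ι × Fin k))) t =
      ∏ j, Complex.exp (-(∑ p, t (p, j) ^ 2 : ℝ) / 2) := by
  rw [(iIndepFun_iff_charFun_pi fun q : ι × Fin k => (hYlaw q.1 q.2).aemeasurable).1 hYind t,
    Fintype.prod_prod_type_right]
  refine Finset.prod_congr rfl fun j _ => ?_
  rw [Complex.ofReal_sum, ← Finset.sum_neg_distrib, Finset.sum_div, Complex.exp_sum]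
  refine Finset.prod_congr rfl fun p _ => ?_
  rw [(hYlaw p j).map_eq, charFun_gaussianReal]
  simp [neg_div]

/-- Central limit theorem for the normalized sums of an orthonormal family of centered functions
over `k` independent i.i.d. samples. -/
theorem tendstoInDistribution_normSum [DecidableEq ι] (hX : ∀ j i, Measurable (X j i))
    (hlaw : ∀ j i, μ.map (X j i) = P)
    (hind : iIndepFun (fun q : Fin k × ℕ => X q.1 q.2) μ) (hφ : ∀ p, Measurable (φ p))
    (hφ2 : ∀ p, MemLp (φ p) 2 P) (hφ0 : ∀ p, ∫ x, φ p x ∂P = 0)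
    (hφ1 : ∀ p q, ∫ x, φ p x * φ q x ∂P = if p = q then 1 else 0)
    {n : ℕ → Fin k → ℕ} (hn : ∀ j, Tendsto (fun N => n N j) atTop atTop)
    {Y : ι → Fin k → Ω' → ℝ}
    (hYlaw : ∀ p j, HasLaw (Y p j) (gaussianReal 0 1) μ')
    (hYind : iIndepFun (fun q : ι × Fin k => Y q.1 q.2) μ') :
    TendstoInDistribution (fun N ω => (WithLp.toLp 2 fun q => normSum φ X (n N) q ω :
      EuclideanSpace ℝ (ι × Fin k))) atTop
      (fun ω => (WithLp.toLp 2 fun q => Y q.1 q.2 ω : EuclideanSpace ℝ (ι × Fin k)))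
      (fun _ => μ) μ' where
  forall_aemeasurable N := by
    refine ((WithLp.measurable_toLp 2 _).comp (measurable_pi_lambda _ fun q => ?_)).aemeasurable
    exact (Finset.measurable_sum _ fun i _ => (hφ q.1).comp (hX q.2 i)).const_mul _
  aemeasurable_limit := (WithLp.measurable_toLp 2 _).comp_aemeasurable
    (aemeasurable_pi_lambda _ fun q => (hYlaw q.1 q.2).aemeasurable)
  tendsto := by
    refine ProbabilityMeasure.tendsto_iff_tendsto_charFun.2 fun t => ?_
    simp only [ProbabilityMeasure.coe_mk]
    rw [charFun_gaussian_family hYlaw hYind]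
    simp only [charFun_normSum hX hlaw hind hφ]
    refine tendsto_finsetProd _ fun j _ => ?_
    have hψ2 : MemLp (fun x => ∑ p, t (p, j) * φ p x) 2 P :=
      memLp_finsetSum _ fun p _ => (hφ2 p).const_mul _
    have h0 : ∫ x, ∑ p, t (p, j) * φ p x ∂P = 0 := by
      rw [integral_finsetSum _ fun p _ => ((hφ2 p).integrable (by norm_num)).const_mul _]
      simp [integral_const_mul, hφ0]
    have h1 : ∫ x, (∑ p, t (p, j) * φ p x) ^ 2 ∂P = ∑ p, t (p, j) ^ 2 := by
      have hi : ∀ p q, Integrable (fun x => t (p, j) * φ p x * (t (q, j) * φ q x)) P :=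
        fun p q => ((hφ2 p).const_mul _).integrable_mul ((hφ2 q).const_mul _)
      simp_rw [sq, Finset.sum_mul_sum]
      rw [integral_finsetSum _ fun p _ => integrable_finsetSum _ fun q _ => hi p q]
      refine Finset.sum_congr rfl fun p _ => ?_
      rw [integral_finsetSum _ fun q _ => hi p q]
      have h2 : ∀ q, ∫ x, t (p, j) * φ p x * (t (q, j) * φ q x) ∂P =
          t (p, j) * t (q, j) * if p = q then 1 else 0 := fun q => by
        rw [← hφ1 p q, ← integral_const_mul]
        refine integral_congr_ae (ae_of_all _ fun x => ?_)
        ring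
      simp [h2]
    have h3 := (tendsto_charFun_inv_sqrt_pow hψ2 h0).comp (hn j)
    rw [h1] at h3
    exact h3

end CLT

/-! ### Pair sums of a finite-rank kernel -/

section Algebra

variable {𝒳 Ω : Type*} {k : ℕ} {ι : Type*}

/-- The average `n_j⁻¹ ∑_{i < n_j} φ_p(X^{(j)}_i)²`. -/
def meanSq (φ : ι → 𝒳 → ℝ) (X : Fin k → ℕ → Ω → 𝒳) (n : Fin k → ℕ) (q : ι × Fin k) (ω : Ω) : ℝ :=
  (∑ i ∈ Finset.range (n q.2), φ q.1 (X q.2 i ω) ^ 2) / n q.2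

/-- The full double sum of `φ p x * φ p y` is a product of two single sums. For `j = l` the excluded
diagonal has to be subtracted, and after normalization it is the average of the squares. -/
theorem crossStat_sum (φ : ι → 𝒳 → ℝ) (lam : ι → ℝ) (s : Finset ι) (X : Fin k → ℕ → Ω → 𝒳)
    (n : Fin k → ℕ) (j l : Fin k) (ω : Ω) :
    crossStat (fun x y => ∑ p ∈ s, lam p * φ p x * φ p y) X n j l ω =
      ∑ p ∈ s, lam p * (normSum φ X n (p, j) ω * normSum φ X n (p, l) ω -
        (if j = l then 1 else 0) * meanSq φ X n (p, j) ω) := by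
  have h1 : ∀ p, normSum φ X n (p, j) ω * normSum φ X n (p, l) ω -
      (if j = l then 1 else 0) * meanSq φ X n (p, j) ω =
      (√(n j))⁻¹ * (√(n l))⁻¹ * ∑ i ∈ Finset.range (n j), ∑ r ∈ Finset.range (n l),
        if (j, i) = (l, r) then 0 else φ p (X j i ω) * φ p (X l r ω) := by
    intro p
    by_cases hjl : j = l
    · subst hjl
      have h2 : ∀ i ∈ Finset.range (n j), (∑ r ∈ Finset.range (n j),
          if (j, i) = (j, r) then 0 else φ p (X j i ω) * φ p (X j r ω)) =
          (∑ r ∈ Finset.range (n j), φ p (X j i ω) * φ p (X j r ω)) - φ p (X j i ω) ^ 2 := by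
        intro i hi
        rw [eq_sub_iff_add_eq, ← Finset.sum_erase_add _ _ hi, ← Finset.sum_erase_add _ _ hi]
        simp only [if_true, add_zero, sq, add_left_inj]
        refine Finset.sum_congr rfl fun r hr => ?_
        rw [if_neg]
        simp only [Prod.mk.injEq, true_and]
        exact (Finset.ne_of_mem_erase hr).symm
      rw [Finset.sum_congr rfl h2, Finset.sum_sub_distrib, ← Finset.sum_mul_sum]
      simp only [normSum, meanSq, if_true]
      have h3 : (√(n j : ℝ))⁻¹ * (√(n j))⁻¹ = (n j : ℝ)⁻¹ := by
        rw [← mul_inv, Real.mul_self_sqrt (Nat.cast_nonneg _)]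
      rw [mul_sub, h3, ← h3, div_eq_mul_inv, ← h3]
      ring
    · have h2 : ∀ i r : ℕ, (j, i) ≠ (l, r) := fun i r h => hjl (Prod.mk.inj h).1
      simp only [h2, if_false, hjl, zero_mul, sub_zero, normSum]
      rw [← Finset.sum_mul_sum]
      ring
  simp only [h1, crossStat]
  have h4 : ∀ i r, (if (j, i) = (l, r) then (0 : ℝ) else
      ∑ p ∈ s, lam p * φ p (X j i ω) * φ p (X l r ω)) =
      ∑ p ∈ s, lam p * (if (j, i) = (l, r) then 0 else φ p (X j i ω) * φ p (X l r ω)) := by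
    intro i r
    split_ifs
    · simp
    · exact Finset.sum_congr rfl fun p _ => by ring
  simp only [h4]
  have h5 : ∀ i, ∑ r ∈ Finset.range (n l), ∑ p ∈ s,
      lam p * (if (j, i) = (l, r) then (0 : ℝ) else φ p (X j i ω) * φ p (X l r ω)) =
      ∑ p ∈ s, lam p * ∑ r ∈ Finset.range (n l),
        (if (j, i) = (l, r) then (0 : ℝ) else φ p (X j i ω) * φ p (X l r ω)) := fun i => by
    rw [Finset.sum_comm]
    simp only [Finset.mul_sum]
  simp only [h5]
  rw [Finset.sum_comm, Finset.mul_sum]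
  refine Finset.sum_congr rfl fun p _ => ?_
  rw [← Finset.mul_sum]
  ring

/-- A linear combination, with coefficients `c j l`, of the normalized pair sums. -/
def quadStat (h : 𝒳 → 𝒳 → ℝ) (X : Fin k → ℕ → Ω → 𝒳) (n : Fin k → ℕ) (c : Fin k → Fin k → ℝ)
    (ω : Ω) : ℝ :=
  ∑ j, ∑ l, c j l * crossStat h X n j l ω

/-- The `p`-th term of the limit in law of `quadStat`. -/
def quadTerm (lam : ι → ℝ) (c : Fin k → Fin k → ℝ) (Y : ι → Fin k → Ω → ℝ) (p : ι) (ω : Ω) : ℝ :=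
  lam p * ∑ j, ∑ l, c j l * (Y p j ω * Y p l ω - if j = l then 1 else 0)

end Algebra

/-! ### Limit in law for finite-rank kernels -/

section FiniteRank

variable {𝒳 : Type*} [MeasurableSpace 𝒳] {P : Measure 𝒳} [IsProbabilityMeasure P]
variable {Ω Ω' : Type*} [MeasurableSpace Ω] [MeasurableSpace Ω'] {μ : Measure Ω}
  [IsProbabilityMeasure μ] {μ' : Measure Ω'} [IsProbabilityMeasure μ'] {k : ℕ}
  {X : Fin k → ℕ → Ω → 𝒳} {ι : Type*} [Fintype ι] {φ : ι → 𝒳 → ℝ}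

omit [Fintype ι] [IsProbabilityMeasure P] [IsProbabilityMeasure μ] in
theorem tendsto_meanSq (hX : ∀ j i, Measurable (X j i)) (hlaw : ∀ j i, μ.map (X j i) = P)
    (hind : iIndepFun (fun q : Fin k × ℕ => X q.1 q.2) μ) (hφ : ∀ p, Measurable (φ p))
    (hφ2 : ∀ p, MemLp (φ p) 2 P) {n : ℕ → Fin k → ℕ}
    (hn : ∀ j, Tendsto (fun N => n N j) atTop atTop) (q : ι × Fin k) :
    ∀ᵐ ω ∂μ, Tendsto (fun N => meanSq φ X (n N) q ω) atTop (𝓝 (∫ x, φ q.1 x ^ 2 ∂P)) := by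
  obtain ⟨p, j⟩ := q
  have hm : Measurable fun x => φ p x ^ 2 := (hφ p).pow_const 2
  have hid : ∀ i, IdentDistrib (fun ω => φ p (X j i ω) ^ 2) (fun ω => φ p (X j 0 ω) ^ 2) μ μ :=
    fun i => (IdentDistrib.mk (hX j i).aemeasurable (hX j 0).aemeasurable
      ((hlaw j i).trans (hlaw j 0).symm)).comp hm
  have hint : Integrable (fun ω => φ p (X j 0 ω) ^ 2) μ := by
    have h := (hφ2 p).integrable_sq
    rw [← hlaw j 0] at h
    exact h.comp_measurable (hX j 0)
  have hpair : Pairwise fun i i' => IndepFun (fun ω => φ p (X j i ω) ^ 2)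
      (fun ω => φ p (X j i' ω) ^ 2) μ := fun i i' hne =>
    (hind.indepFun (i := (j, i)) (j := (j, i')) (by simpa using hne)).comp hm hm
  have hval : ∫ ω, φ p (X j 0 ω) ^ 2 ∂μ = ∫ x, φ p x ^ 2 ∂P := by
    rw [← hlaw j 0, integral_map (hX j 0).aemeasurable hm.aestronglyMeasurable]
  filter_upwards [strong_law_ae_real (fun i ω => φ p (X j i ω) ^ 2) hint hpair hid] with ω hω
  rw [hval] at hω
  exact hω.comp (hn j)

/-- The statistic is a continuous function of the normalized sums, which converge in law, and of the
coefficients and average squares, which converge in probability to constants. Slutsky's theorem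
applies. The limit `1` of the average squares is the source of the `-1` in `Y² - 1`. -/
theorem tendstoInDistribution_quadStat_finite [DecidableEq ι] (hX : ∀ j i, Measurable (X j i))
    (hlaw : ∀ j i, μ.map (X j i) = P)
    (hind : iIndepFun (fun q : Fin k × ℕ => X q.1 q.2) μ) (hφ : ∀ p, Measurable (φ p))
    (hφ2 : ∀ p, MemLp (φ p) 2 P) (hφ0 : ∀ p, ∫ x, φ p x ∂P = 0)
    (hφ1 : ∀ p q, ∫ x, φ p x * φ q x ∂P = if p = q then 1 else 0)
    {n : ℕ → Fin k → ℕ} (hn : ∀ j, Tendsto (fun N => n N j) atTop atTop)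
    {c : ℕ → Fin k → Fin k → ℝ} {c₀ : Fin k → Fin k → ℝ} (hc : Tendsto c atTop (𝓝 c₀))
    (lam : ι → ℝ) {Y : ι → Fin k → Ω' → ℝ}
    (hYlaw : ∀ p j, HasLaw (Y p j) (gaussianReal 0 1) μ')
    (hYind : iIndepFun (fun q : ι × Fin k => Y q.1 q.2) μ') :
    TendstoInDistribution
      (fun N ω => quadStat (fun x y => ∑ p, lam p * φ p x * φ p y) X (n N) (c N) ω) atTop
      (fun ω => ∑ p, quadTerm lam c₀ Y p ω) (fun _ => μ) μ' := by
  have hclt := tendstoInDistribution_normSum hX hlaw hind hφ hφ2 hφ0 hφ1 hn hYlaw hYind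
  have hDmeas : ∀ N q, Measurable (meanSq φ X (n N) q) := fun N q =>
    (Finset.measurable_sum _ fun i _ => ((hφ q.1).comp (hX q.2 i)).pow_const 2).div_const _
  let D : ℕ → Ω → (Fin k → Fin k → ℝ) × (ι × Fin k → ℝ) := fun N ω =>
    (c N, fun q => meanSq φ X (n N) q ω)
  have hD : ∀ N, Measurable (D N) := fun N =>
    measurable_const.prodMk (measurable_pi_lambda _ fun q => hDmeas N q)
  have hDlim : TendstoInMeasure μ D atTop fun _ => (c₀, fun _ => 1) := by
    refine tendstoInMeasure_of_tendsto_ae (fun N => (hD N).aestronglyMeasurable) ?_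
    have h := ae_all_iff.2 fun q : ι × Fin k => tendsto_meanSq hX hlaw hind hφ hφ2 hn q
    filter_upwards [h] with ω hω
    refine hc.prodMk_nhds (tendsto_pi_nhds.2 fun q => ?_)
    have h1 := hω q
    simpa only [sq, hφ1, if_true] using h1
  let G : EuclideanSpace ℝ (ι × Fin k) × ((Fin k → Fin k → ℝ) × (ι × Fin k → ℝ)) → ℝ := fun z =>
    ∑ j, ∑ l, z.2.1 j l * ∑ p, lam p * (z.1 (p, j) * z.1 (p, l) -
      (if j = l then 1 else 0) * z.2.2 (p, j))
  have hG : Continuous G := by fun_prop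
  have h := hclt.continuous_comp_prodMk_of_tendstoInMeasure_const hG hDlim
    fun N => (hD N).aemeasurable
  refine h.congr (fun N => ae_of_all _ fun ω => ?_) (ae_of_all _ fun ω => ?_)
  · simp only [G, D, quadStat, crossStat_sum]
  · simp only [G, quadTerm, mul_one, Finset.mul_sum]
    symm
    rw [Finset.sum_comm]
    refine Finset.sum_congr rfl fun j _ => ?_
    rw [Finset.sum_comm]
    refine Finset.sum_congr rfl fun l _ => Finset.sum_congr rfl fun p _ => ?_
    ring

end FiniteRank

/-! ### Comparison of characteristic functions and exchange of limits -/

section Approximation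

variable {Ω : Type*} [MeasurableSpace Ω] {μ : Measure Ω} [IsProbabilityMeasure μ]

/-- Integrated form of `|exp(itx) - exp(ity)| ≤ |t| |x - y|`. -/
theorem norm_charFun_map_sub_le {f g : Ω → ℝ} (hf : AEMeasurable f μ) (hg : AEMeasurable g μ)
    (hfg : Integrable (fun ω => f ω - g ω) μ) (t : ℝ) :
    ‖charFun (μ.map f) t - charFun (μ.map g) t‖ ≤ |t| * ∫ ω, |f ω - g ω| ∂μ := by
  rw [charFun_apply_real, charFun_apply_real, integral_map hf (by fun_prop),
    integral_map hg (by fun_prop), ← integral_sub]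
  · rw [← integral_const_mul]
    refine norm_integral_le_of_norm_le (hfg.abs.const_mul _) (ae_of_all _ fun ω => ?_)
    have h1 : Complex.exp (t * f ω * Complex.I) - Complex.exp (t * g ω * Complex.I) =
        Complex.exp (t * g ω * Complex.I) *
          (Complex.exp (Complex.I * ((t * (f ω - g ω) : ℝ) : ℂ)) - 1) := by
      rw [mul_sub, ← Complex.exp_add, mul_one]
      congr 2
      push_cast
      ring
    have h2 : ‖Complex.exp (t * g ω * Complex.I)‖ = 1 := by
      rw [← Complex.ofReal_mul, Complex.norm_exp_ofReal_mul_I]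
    rw [h1, norm_mul, h2, one_mul]
    refine Real.norm_exp_I_mul_ofReal_sub_one_le.trans ?_
    rw [norm_mul, Real.norm_eq_abs, Real.norm_eq_abs]
  all_goals
    refine Integrable.of_bound (by fun_prop) 1 (ae_of_all _ fun ω => ?_)
    rw [← Complex.ofReal_mul, Complex.norm_exp_ofReal_mul_I]

/-- The variance of `|f|` is nonnegative. -/
theorem integral_abs_le_sqrt {f : Ω → ℝ} (hf : MemLp f 2 μ) :
    ∫ ω, |f ω| ∂μ ≤ √(∫ ω, f ω ^ 2 ∂μ) := by
  refine Real.le_sqrt_of_sq_le ?_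
  have h := variance_nonneg |f| μ
  rw [variance_eq_sub hf.abs] at h
  simpa using h

/-- An `ε / 3` argument. The error `δ L` is free of `N`, although the range of `N` where it is valid
may depend on `L`. -/
theorem tendsto_of_forall_approx {α : Type*} [PseudoMetricSpace α] {f : ℕ → α} {a : α}
    {F : ℕ → ℕ → α} {A : ℕ → α} {δ : ℕ → ℝ} (hF : ∀ L, Tendsto (F L) atTop (𝓝 (A L)))
    (hA : Tendsto A atTop (𝓝 a)) (hδ : Tendsto δ atTop (𝓝 0))
    (hfF : ∀ L, ∀ᶠ N in atTop, dist (f N) (F L N) ≤ δ L) : Tendsto f atTop (𝓝 a) := by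
  rw [Metric.tendsto_nhds]
  intro ε hε
  obtain ⟨L, hL1, hL2⟩ := ((Metric.tendsto_nhds.1 hA (ε / 3) (by positivity)).and
    (hδ.eventually_lt_const (by positivity : (0 : ℝ) < ε / 3))).exists
  filter_upwards [hfF L, Metric.tendsto_nhds.1 (hF L) (ε / 3) (by positivity)] with N h1 h2
  have h3 := dist_triangle4 (f N) (F L N) (A L) a
  linarith

end Approximation

/-! ### Convergence of the limiting series -/

section Limit

variable {Ω : Type*} [MeasurableSpace Ω] {μ : Measure Ω} [IsProbabilityMeasure μ] {k : ℕ}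

omit [IsProbabilityMeasure μ] in
theorem aemeasurable_quadTerm {ι : Type*} (lam : ι → ℝ) (c : Fin k → Fin k → ℝ)
    {Y : ι → Fin k → Ω → ℝ} (hY : ∀ p j, AEMeasurable (Y p j) μ) (p : ι) :
    AEMeasurable (quadTerm lam c Y p) μ := by
  unfold quadTerm
  fun_prop

/-- Since `|Y_j Y_l - δ_{jl}| ≤ 1 + ∑ Y_j²`, the terms are dominated, up to a constant, by `|λ_p| (1
+ ∑ Y_{p,j}²)`. The expected sum of these is finite, so absolute convergence needs no independence
of the `Y`. -/
theorem ae_summable_quadTerm {lam : ℕ → ℝ} (hlam : Summable lam) (c : Fin k → Fin k → ℝ)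
    {Y : ℕ → Fin k → Ω → ℝ} (hYlaw : ∀ p j, HasLaw (Y p j) (gaussianReal 0 1) μ) :
    ∀ᵐ ω ∂μ, Summable fun p => quadTerm lam c Y p ω := by
  have hYm : ∀ p j, AEMeasurable (Y p j) μ := fun p j => (hYlaw p j).aemeasurable
  let R : ℕ → Ω → ENNReal := fun p ω => ‖lam p‖ₑ * (1 + ∑ j, ‖Y p j ω ^ 2‖ₑ)
  have hsq : ∀ p j, ∫⁻ ω, ‖Y p j ω ^ 2‖ₑ ∂μ = ∫⁻ y, ‖y ^ 2‖ₑ ∂(gaussianReal 0 1) := fun p j => by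
    rw [← (hYlaw p j).map_eq, lintegral_map' (by fun_prop) (hYm p j)]
  have hfin : ∫⁻ y, ‖y ^ 2‖ₑ ∂(gaussianReal 0 1) ≠ ⊤ :=
    ((memLp_id_gaussianReal (μ := 0) (v := 1) 2).integrable_sq.2).ne
  have hRm : ∀ p, AEMeasurable (R p) μ := fun p => by
    unfold R
    fun_prop
  have hR : ∀ p, ∫⁻ ω, R p ω ∂μ =
      ‖lam p‖ₑ * (1 + k * ∫⁻ y, ‖y ^ 2‖ₑ ∂(gaussianReal 0 1)) := fun p => by
    rw [lintegral_const_mul'' _ (by fun_prop), lintegral_add_left' (by fun_prop),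
      lintegral_finsetSum' _ (by fun_prop)]
    simp only [hsq]
    simp
  have hsum : ∫⁻ ω, ∑' p, R p ω ∂μ ≠ ⊤ := by
    rw [lintegral_tsum hRm]
    simp only [hR]
    rw [ENNReal.tsum_mul_right]
    refine ENNReal.mul_ne_top (tsum_enorm_ne_top_iff_summable_norm.2 hlam.norm) ?_
    exact ENNReal.add_ne_top.2 ⟨ENNReal.one_ne_top, ENNReal.mul_ne_top (by simp) hfin⟩
  filter_upwards [ae_lt_top' (AEMeasurable.tsum hRm) hsum] with ω hω
  have hs : Summable fun p => |lam p| * (1 + ∑ j, Y p j ω ^ 2) := by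
    refine (tsum_enorm_ne_top_iff_summable_norm.1 ?_).of_norm
    refine ne_top_of_le_ne_top hω.ne (ENNReal.tsum_le_tsum fun p => ?_)
    rw [enorm_mul]
    refine mul_le_mul' (by simp) ((enorm_add_le _ _).trans (add_le_add (by simp) ?_))
    exact enorm_sum_le _ _
  refine Summable.of_norm_bounded (hs.mul_left (∑ j, ∑ l, |c j l|)) fun p => ?_
  rw [quadTerm, norm_mul, Real.norm_eq_abs]
  have h1 : ‖∑ j, ∑ l, c j l * (Y p j ω * Y p l ω - if j = l then 1 else 0)‖ ≤
      (∑ j, ∑ l, |c j l|) * (1 + ∑ j, Y p j ω ^ 2) := by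
    simp only [Finset.sum_mul]
    refine (norm_sum_le _ _).trans (Finset.sum_le_sum fun j _ => (norm_sum_le _ _).trans
      (Finset.sum_le_sum fun l _ => ?_))
    rw [norm_mul, Real.norm_eq_abs, Real.norm_eq_abs]
    refine mul_le_mul_of_nonneg_left ?_ (abs_nonneg _)
    have hj := Finset.single_le_sum (f := fun j => Y p j ω ^ 2) (fun _ _ => sq_nonneg _)
      (Finset.mem_univ j)
    have hl := Finset.single_le_sum (f := fun j => Y p j ω ^ 2) (fun _ _ => sq_nonneg _)
      (Finset.mem_univ l)
    rw [abs_le]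
    constructor <;> split_ifs <;>
      nlinarith [sq_nonneg (Y p j ω - Y p l ω), sq_nonneg (Y p j ω + Y p l ω)]
  calc _ ≤ |lam p| * ((∑ j, ∑ l, |c j l|) * (1 + ∑ j, Y p j ω ^ 2)) :=
        mul_le_mul_of_nonneg_left h1 (abs_nonneg _)
    _ = _ := by ring

omit [IsProbabilityMeasure μ] in
theorem aemeasurable_tsum_of_ae_summable {f : ℕ → Ω → ℝ} (hf : ∀ p, AEMeasurable (f p) μ)
    (hs : ∀ᵐ ω ∂μ, Summable fun p => f p ω) : AEMeasurable (fun ω => ∑' p, f p ω) μ :=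
  aemeasurable_of_tendsto_metrizable_ae atTop
    (fun L => Finset.aemeasurable_fun_sum (Finset.range L) fun p _ => hf p)
    (hs.mono fun _ h => h.hasSum.tendsto_sum_nat)

/-- Partial sums of an a.s. convergent series converge in law, in terms of characteristic
functions. -/
theorem tendsto_charFun_partialSum {f : ℕ → Ω → ℝ} (hf : ∀ p, AEMeasurable (f p) μ)
    (hs : ∀ᵐ ω ∂μ, Summable fun p => f p ω) (t : ℝ) :
    Tendsto (fun L => charFun (μ.map fun ω => ∑ p ∈ Finset.range L, f p ω) t) atTop
      (𝓝 (charFun (μ.map fun ω => ∑' p, f p ω) t)) := by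
  have hm : ∀ L, AEMeasurable (fun ω => ∑ p ∈ Finset.range L, f p ω) μ := fun L =>
    Finset.aemeasurable_fun_sum _ fun p _ => hf p
  have hlim : ∀ᵐ ω ∂μ, Tendsto (fun L => ∑ p ∈ Finset.range L, f p ω) atTop
      (𝓝 (∑' p, f p ω)) := hs.mono fun ω h => h.hasSum.tendsto_sum_nat
  have hm' := aemeasurable_tsum_of_ae_summable hf hs
  have h := tendstoInMeasure_of_tendsto_ae (fun L => (hm L).aestronglyMeasurable) hlim
  have h1 := (h.tendstoInDistribution_of_aemeasurable hm hm').tendsto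
  exact ProbabilityMeasure.tendsto_iff_tendsto_charFun.1 h1 t

end Limit

/-! ### From finite rank to the full degenerate kernel -/

section Main

variable {𝒳 : Type*} [MeasurableSpace 𝒳] {P : Measure 𝒳} [IsProbabilityMeasure P]
variable {Ω Ω' : Type*} [MeasurableSpace Ω] [MeasurableSpace Ω'] {μ : Measure Ω}
  [IsProbabilityMeasure μ] {μ' : Measure Ω'} [IsProbabilityMeasure μ'] {k : ℕ}
  {X : Fin k → ℕ → Ω → 𝒳}

/-- Bounded eigenfunctions `φ p` for the nonzero `lam p`, which expand the kernel `h`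
in `L²(P ⊗ P)`. -/
structure IsEigenExpansion (h : 𝒳 → 𝒳 → ℝ) (P : Measure 𝒳) (lam : ℕ → ℝ) (φ : ℕ → 𝒳 → ℝ) :
    Prop where
  summable : Summable lam
  measurable : ∀ p, Measurable (φ p)
  bounded : ∀ p, ∃ C, ∀ x, ‖φ p x‖ ≤ C
  integral_eq_zero : ∀ p, ∫ x, φ p x ∂P = 0
  integral_mul : ∀ p q, ∫ x, φ p x * φ q x ∂P = if p = q ∧ lam p ≠ 0 then 1 else 0
  tendsto : Tendsto (fun N : ℕ => ∫ z, (h z.1 z.2 - ∑ p ∈ Finset.range N,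
    lam p * φ p z.1 * φ p z.2) ^ 2 ∂(P.prod P)) atTop (𝓝 0)

omit [MeasurableSpace 𝒳] [MeasurableSpace Ω] in
theorem quadStat_sub (h h' : 𝒳 → 𝒳 → ℝ) (n : Fin k → ℕ) (c : Fin k → Fin k → ℝ) (ω : Ω) :
    quadStat h X n c ω - quadStat h' X n c ω =
      quadStat (fun x y => h x y - h' x y) X n c ω := by
  simp only [quadStat, crossStat, ← Finset.sum_sub_distrib, ← mul_sub]
  refine Finset.sum_congr rfl fun j _ => Finset.sum_congr rfl fun l _ => ?_
  congr 2
  refine Finset.sum_congr rfl fun i _ => Finset.sum_congr rfl fun r _ => ?_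
  split_ifs <;> simp

theorem measurable_quadStat {h : 𝒳 → 𝒳 → ℝ} (hh : Measurable fun z : 𝒳 × 𝒳 => h z.1 z.2)
    (hX : ∀ j i, Measurable (X j i)) (n : Fin k → ℕ) (c : Fin k → Fin k → ℝ) :
    Measurable (quadStat h X n c) :=
  Finset.measurable_sum _ fun j _ => Finset.measurable_sum _ fun l _ =>
    (measurable_crossStat hh hX n j l).const_mul _

omit [IsProbabilityMeasure P] in
theorem memLp_crossStat {h : 𝒳 → 𝒳 → ℝ} (hh : IsDegenerateKernel h P)
    (hX : ∀ j i, Measurable (X j i)) (n : Fin k → ℕ) (j l : Fin k) :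
    MemLp (crossStat h X n j l) 2 μ := by
  obtain ⟨C, hC⟩ := hh.bounded
  have h1 : ∀ i r, MemLp (fun ω => if (j, i) = (l, r) then 0 else h (X j i ω) (X l r ω)) 2 μ := by
    intro i r
    split_ifs
    · exact memLp_const 0
    · exact MemLp.of_bound (hh.measurable.comp ((hX j i).prodMk (hX l r))).aestronglyMeasurable C
        (ae_of_all _ fun ω => hC _ _)
  have h2 : MemLp (fun ω => ∑ i ∈ Finset.range (n j), ∑ r ∈ Finset.range (n l),
      if (j, i) = (l, r) then 0 else h (X j i ω) (X l r ω)) 2 μ :=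
    memLp_finsetSum _ fun i _ => memLp_finsetSum _ fun r _ => h1 i r
  exact h2.const_mul _

omit [IsProbabilityMeasure P] in
theorem integral_abs_quadStat_le {h : 𝒳 → 𝒳 → ℝ} (hh : IsDegenerateKernel h P)
    (hX : ∀ j i, Measurable (X j i)) (hlaw : ∀ j i, μ.map (X j i) = P)
    (hind : iIndepFun (fun q : Fin k × ℕ => X q.1 q.2) μ) (n : Fin k → ℕ)
    (c : Fin k → Fin k → ℝ) :
    ∫ ω, |quadStat h X n c ω| ∂μ ≤
      (∑ j, ∑ l, |c j l|) * √(2 * ∫ z, h z.1 z.2 ^ 2 ∂(P.prod P)) := by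
  have hm := memLp_crossStat (μ := μ) hh hX n
  have hint : ∀ j l, Integrable (fun ω => |c j l| * |crossStat h X n j l ω|) μ := fun j l =>
    ((hm j l).integrable (by norm_num)).abs.const_mul _
  calc ∫ ω, |quadStat h X n c ω| ∂μ
      ≤ ∫ ω, ∑ j, ∑ l, |c j l| * |crossStat h X n j l ω| ∂μ := by
        refine integral_mono_of_nonneg (ae_of_all _ fun ω => abs_nonneg _)
          (integrable_finsetSum _ fun j _ => integrable_finsetSum _ fun l _ => hint j l)
          (ae_of_all _ fun ω => ?_)
        refine (Finset.abs_sum_le_sum_abs _ _).trans (Finset.sum_le_sum fun j _ =>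
          (Finset.abs_sum_le_sum_abs _ _).trans (Finset.sum_le_sum fun l _ => ?_))
        rw [abs_mul]
    _ = ∑ j, ∑ l, |c j l| * ∫ ω, |crossStat h X n j l ω| ∂μ := by
        rw [integral_finsetSum _ fun j _ => integrable_finsetSum _ fun l _ => hint j l]
        refine Finset.sum_congr rfl fun j _ => ?_
        rw [integral_finsetSum _ fun l _ => hint j l]
        simp only [integral_const_mul]
    _ ≤ _ := by
        simp only [Finset.sum_mul]
        refine Finset.sum_le_sum fun j _ => Finset.sum_le_sum fun l _ =>
          mul_le_mul_of_nonneg_left ?_ (abs_nonneg _)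
        exact (integral_abs_le_sqrt (hm j l)).trans
          (Real.sqrt_le_sqrt (integral_crossStat_sq_le hh hX hlaw hind n j l))

namespace IsEigenExpansion

variable {h : 𝒳 → 𝒳 → ℝ} {lam : ℕ → ℝ} {φ : ℕ → 𝒳 → ℝ}

theorem isDegenerateKernel_truncation (hφ : IsEigenExpansion h P lam φ) (L : ℕ) :
    IsDegenerateKernel (fun x y => ∑ p ∈ Finset.range L, lam p * φ p x * φ p y) P where
  measurable := Finset.measurable_sum _ fun p _ =>
    (((hφ.measurable p).comp measurable_fst).const_mul _).mul
      ((hφ.measurable p).comp measurable_snd)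
  bounded := by
    choose C hC using hφ.bounded
    refine ⟨∑ p ∈ Finset.range L, ‖lam p‖ * C p * C p, fun x y =>
      (norm_sum_le _ _).trans (Finset.sum_le_sum fun p _ => ?_)⟩
    have h1 := hC p x
    have h2 := hC p y
    have h3 : 0 ≤ C p := (norm_nonneg _).trans h1
    rw [norm_mul, norm_mul]
    gcongr
  symm x y := Finset.sum_congr rfl fun p _ => by ring
  integral_eq_zero x := by
    rw [integral_finsetSum]
    · simp [integral_const_mul, hφ.integral_eq_zero]
    · intro p _
      obtain ⟨C, hC⟩ := hφ.bounded p
      exact (Integrable.of_bound (hφ.measurable p).aestronglyMeasurable C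
        (ae_of_all _ hC)).const_mul _

theorem tendstoInDistribution_truncation (hφ : IsEigenExpansion h P lam φ)
    (hX : ∀ j i, Measurable (X j i)) (hlaw : ∀ j i, μ.map (X j i) = P)
    (hind : iIndepFun (fun q : Fin k × ℕ => X q.1 q.2) μ)
    {n : ℕ → Fin k → ℕ} (hn : ∀ j, Tendsto (fun N => n N j) atTop atTop)
    {c : ℕ → Fin k → Fin k → ℝ} {c₀ : Fin k → Fin k → ℝ} (hc : Tendsto c atTop (𝓝 c₀))
    {Y : ℕ → Fin k → Ω' → ℝ} (hYlaw : ∀ p j, HasLaw (Y p j) (gaussianReal 0 1) μ')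
    (hYind : iIndepFun (fun q : ℕ × Fin k => Y q.1 q.2) μ') (L : ℕ) :
    TendstoInDistribution
      (fun N ω => quadStat (fun x y => ∑ p ∈ Finset.range L, lam p * φ p x * φ p y)
        X (n N) (c N) ω) atTop
      (fun ω => ∑ p ∈ Finset.range L, quadTerm lam c₀ Y p ω) (fun _ => μ) μ' := by
  -- The family `φ p` is orthonormal only over the indices with `lam p ≠ 0`. The others contribute
  -- nothing to the kernel or to the limit and are dropped before the central limit theorem is
  -- applied.
  let s := (Finset.range L).filter fun p => lam p ≠ 0
  have hsne : ∀ p : s, lam p ≠ 0 := fun p => (Finset.mem_filter.1 p.2).2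
  have hfin := tendstoInDistribution_quadStat_finite (ι := s) (φ := fun p => φ p) hX hlaw hind
    (fun p => hφ.measurable p)
    (fun p => by
      obtain ⟨C, hC⟩ := hφ.bounded p
      exact MemLp.of_bound (hφ.measurable p).aestronglyMeasurable C (ae_of_all _ hC))
    (fun p => hφ.integral_eq_zero p)
    (fun p q => by rw [hφ.integral_mul]; simp [hsne p])
    hn hc (fun p => lam p) (Y := fun p => Y p) (fun p j => hYlaw p j)
    (hYind.precomp (g := fun q : s × Fin k => ((q.1 : ℕ), q.2)) (fun q q' hq => by
      simp only [Prod.mk.injEq] at hq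
      exact Prod.ext (Subtype.ext hq.1) hq.2))
  have hsum : ∀ f : ℕ → ℝ, (∀ p, lam p = 0 → f p = 0) →
      ∑ p : s, f p = ∑ p ∈ Finset.range L, f p := fun f hf => by
    rw [Finset.sum_coe_sort s f]
    exact Finset.sum_filter_of_ne fun p _ hp h0 => hp (hf p h0)
  refine hfin.congr (fun N => ae_of_all _ fun ω => ?_) (ae_of_all _ fun ω => ?_)
  · congr 1
    funext x y
    exact hsum (fun p => lam p * φ p x * φ p y) fun p hp => by simp [hp]
  · exact hsum (fun p => quadTerm lam c₀ Y p ω) fun p hp => by simp [quadTerm, hp]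

/-- Limit in law of a quadratic statistic of a degenerate kernel. The statistic `S N` has to be
equal to the quadratic one only for large `N`. -/
theorem tendstoInDistribution_quadStat (hφ : IsEigenExpansion h P lam φ)
    (hh : IsDegenerateKernel h P)
    (hX : ∀ j i, Measurable (X j i)) (hlaw : ∀ j i, μ.map (X j i) = P)
    (hind : iIndepFun (fun q : Fin k × ℕ => X q.1 q.2) μ)
    {n : ℕ → Fin k → ℕ} (hn : ∀ j, Tendsto (fun N => n N j) atTop atTop)
    {c : ℕ → Fin k → Fin k → ℝ} {c₀ : Fin k → Fin k → ℝ} (hc : Tendsto c atTop (𝓝 c₀))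
    {Y : ℕ → Fin k → Ω' → ℝ} (hYlaw : ∀ p j, HasLaw (Y p j) (gaussianReal 0 1) μ')
    (hYind : iIndepFun (fun q : ℕ × Fin k => Y q.1 q.2) μ')
    {S : ℕ → Ω → ℝ} (hS : ∀ N, Measurable (S N))
    (hSeq : ∀ᶠ N in atTop, ∀ ω, S N ω = quadStat h X (n N) (c N) ω) :
    TendstoInDistribution S atTop (fun ω => ∑' p, quadTerm lam c₀ Y p ω) (fun _ => μ) μ' where
  forall_aemeasurable N := (hS N).aemeasurable
  aemeasurable_limit := aemeasurable_tsum_of_ae_summable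
    (aemeasurable_quadTerm lam c₀ fun p j => (hYlaw p j).aemeasurable)
    (ae_summable_quadTerm hφ.summable c₀ hYlaw)
  tendsto := by
    refine ProbabilityMeasure.tendsto_iff_tendsto_charFun.2 fun t => ?_
    simp only [ProbabilityMeasure.coe_mk]
    let hL : ℕ → 𝒳 → 𝒳 → ℝ := fun L x y => ∑ p ∈ Finset.range L, lam p * φ p x * φ p y
    let V : ℕ → ℝ := fun L => ∫ z, (h z.1 z.2 - hL L z.1 z.2) ^ 2 ∂(P.prod P)
    -- The slack `1` makes this a bound for the coefficients of all large `N`, so that the error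
    -- does not depend on `N`.
    let K : ℝ := ∑ j, ∑ l, |c₀ j l| + 1
    have hKlim : Tendsto (fun N => ∑ j, ∑ l, |c N j l|) atTop (𝓝 (∑ j, ∑ l, |c₀ j l|)) :=
      tendsto_finsetSum _ fun j _ => tendsto_finsetSum _ fun l _ =>
        ((tendsto_pi_nhds.1 ((tendsto_pi_nhds.1 hc) j)) l).abs
    have hK : ∀ᶠ N in atTop, ∑ j, ∑ l, |c N j l| ≤ K :=
      (hKlim.eventually_lt_const (lt_add_one _)).mono fun _ h => h.le
    refine tendsto_of_forall_approx
      (F := fun L N => charFun (μ.map (quadStat (hL L) X (n N) (c N))) t)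
      (A := fun L => charFun (μ'.map fun ω => ∑ p ∈ Finset.range L, quadTerm lam c₀ Y p ω) t)
      (δ := fun L => |t| * (K * √(2 * V L))) (fun L => ?_) ?_ ?_ (fun L => ?_)
    · exact ProbabilityMeasure.tendsto_iff_tendsto_charFun.1
        (hφ.tendstoInDistribution_truncation hX hlaw hind hn hc hYlaw hYind L).tendsto t
    · exact tendsto_charFun_partialSum
        (aemeasurable_quadTerm lam c₀ fun p j => (hYlaw p j).aemeasurable)
        (ae_summable_quadTerm hφ.summable c₀ hYlaw) t
    · have h1 := ((hφ.tendsto.const_mul 2).sqrt.const_mul K).const_mul |t|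
      simpa using h1
    -- The remainder of the expansion is itself degenerate, so the uniform second moment bound
    -- applies to it with `V L`.
    · have hd : IsDegenerateKernel (fun x y => h x y - hL L x y) P := by
        have hd' : IsDegenerateKernel (hL L) P := hφ.isDegenerateKernel_truncation L
        obtain ⟨C, hC⟩ := hh.bounded
        obtain ⟨C', hC'⟩ := hd'.bounded
        refine ⟨hh.measurable.sub hd'.measurable, ⟨C + C', fun x y =>
          (norm_sub_le _ _).trans (add_le_add (hC x y) (hC' x y))⟩, fun x y => ?_, fun x => ?_⟩
        · rw [hh.symm x y, hd'.symm x y]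
        · rw [integral_sub, hh.integral_eq_zero, hd'.integral_eq_zero, sub_zero]
          · exact Integrable.of_bound (hh.measurable.comp measurable_prodMk_left).aestronglyMeasurable
              C (ae_of_all _ (hC x))
          · exact Integrable.of_bound (hd'.measurable.comp measurable_prodMk_left).aestronglyMeasurable
              C' (ae_of_all _ (hC' x))
      filter_upwards [hSeq, hK] with N h1 h2
      have hSN : S N = quadStat h X (n N) (c N) := funext h1
      have hm := measurable_quadStat hh.measurable hX (n N) (c N)
      have hmL := measurable_quadStat (h := hL L)
        (hφ.isDegenerateKernel_truncation L).measurable hX (n N) (c N)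
      rw [hSN, dist_eq_norm]
      refine (norm_charFun_map_sub_le hm.aemeasurable hmL.aemeasurable ?_ t).trans ?_
      · simp only [quadStat_sub]
        exact integrable_finsetSum _ fun j _ => integrable_finsetSum _ fun l _ =>
          ((memLp_crossStat hd hX (n N) j l).integrable (by norm_num)).const_mul _
      · simp only [quadStat_sub]
        refine mul_le_mul_of_nonneg_left ?_ (abs_nonneg t)
        exact (integral_abs_quadStat_le hd hX hlaw hind (n N) (c N)).trans
          (mul_le_mul_of_nonneg_right h2 (Real.sqrt_nonneg _))

end IsEigenExpansion

end Main

/-! ### Law and independence of the variables `Z_p` -/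

section ChiSquared

variable {Ω : Type*} [MeasurableSpace Ω] {μ : Measure Ω}

/-- The rows of an independent array of random variables are independent. -/
theorem iIndepFun_rows [IsProbabilityMeasure μ] {ι κ E : Type*} [Countable ι] [Countable κ]
    [MeasurableSpace E] {Y : ι → κ → Ω → E} (hY : ∀ i j, AEMeasurable (Y i j) μ)
    (hind : iIndepFun (fun q : ι × κ => Y q.1 q.2) μ) :
    iIndepFun (fun i ω j => Y i j ω) μ := by
  have hp : ∀ i j, IsProbabilityMeasure (μ.map (Y i j)) := fun i j =>
    Measure.isProbabilityMeasure_map (hY i j)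
  have hrow : ∀ i, AEMeasurable (fun ω j => Y i j ω) μ := fun i => aemeasurable_pi_iff.2 (hY i)
  have hall : AEMeasurable (fun ω (q : ι × κ) => Y q.1 q.2 ω) μ :=
    aemeasurable_pi_iff.2 fun q => hY q.1 q.2
  rw [iIndepFun_iff_map_fun_eq_infinitePi_map₀' hrow]
  have h1 : ∀ i, μ.map (fun ω j => Y i j ω) = Measure.infinitePi fun j => μ.map (Y i j) := fun i =>
    (hind.precomp (g := fun j => (i, j)) (Prod.mk_right_injective i)).map_fun_eq_infinitePi_map₀
      (hrow i)
  simp only [h1]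
  -- The joint law of the array is a product measure over `ι × κ`. Currying turns it into the
  -- product of the laws of the rows.
  rw [← Measure.infinitePi_map_curry fun i j => μ.map (Y i j),
    ← hind.map_fun_eq_infinitePi_map₀ hall,
    AEMeasurable.map_map_of_aemeasurable (MeasurableEquiv.curry ι κ E).measurable.aemeasurable hall]
  rfl

variable [IsProbabilityMeasure μ] {k : ℕ} {Y : ℕ → Fin k → Ω → ℝ}

omit [IsProbabilityMeasure μ] in
theorem hasLaw_sumSq (hYlaw : ∀ p j, HasLaw (Y p j) (gaussianReal 0 1) μ)
    (hYind : iIndepFun (fun q : ℕ × Fin k => Y q.1 q.2) μ) (p : ℕ) :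
    HasLaw (sumSq Y p) (chiSquared k) μ where
  aemeasurable := by
    have := fun j => (hYlaw p j).aemeasurable
    unfold sumSq
    fun_prop
  map_eq := by
    have hY := fun j => (hYlaw p j).aemeasurable
    have hrow : AEMeasurable (fun ω j => Y p j ω) μ := aemeasurable_pi_iff.2 hY
    have h1 := (hYind.precomp (g := fun j => (p, j))
      (Prod.mk_right_injective p)).map_fun_eq_pi_map hY
    simp only [(hYlaw p _).map_eq] at h1
    rw [chiSquared, ← h1, AEMeasurable.map_map_of_aemeasurable
      (Measurable.aemeasurable (by fun_prop)) hrow]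
    rfl

theorem iIndepFun_sumSq (hYlaw : ∀ p j, HasLaw (Y p j) (gaussianReal 0 1) μ)
    (hYind : iIndepFun (fun q : ℕ × Fin k => Y q.1 q.2) μ) : iIndepFun (sumSq Y) μ :=
  (iIndepFun_rows (fun p j => (hYlaw p j).aemeasurable) hYind).comp
    (fun _ v => ∑ j, v j ^ 2) fun _ => by fun_prop

end ChiSquared

/-! ### Mean element and centered kernel -/

section Centering

variable {𝒳 : Type*} [MeasurableSpace 𝒳] {H : Type*} [NormedAddCommGroup H]
  [InnerProductSpace ℝ H] [CompleteSpace H] [RKHS ℝ H 𝒳 ℝ]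

omit [MeasurableSpace 𝒳] in
theorem dense_span_featureMap :
    Dense (Submodule.span ℝ (Set.range (featureMap H : 𝒳 → H)) : Set H) := by
  rw [Submodule.dense_iff_topologicalClosure_eq_top, Submodule.topologicalClosure_eq_top_iff,
    Submodule.eq_bot_iff]
  intro f hf
  refine RKHS.ext fun x => ?_
  rw [← inner_featureMap, real_inner_comm, RKHS.coe_zero]
  exact (Submodule.mem_orthogonal _ f).1 hf _ (Submodule.subset_span ⟨x, rfl⟩)

/-- Kernel sections are measurable, hence so are their finite linear combinations. These are dense
in `H`, and norm convergence implies pointwise convergence, so no separability of `H` enters. -/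
theorem measurable_coe (hmeas : Measurable fun z : 𝒳 × 𝒳 => kern H z.1 z.2) (f : H) :
    Measurable fun x => f x := by
  have hker : ∀ x : 𝒳, Measurable fun y => (featureMap H x) y := fun x => by
    have h : (fun y => (featureMap H x) y) = fun y => kern H x y :=
      funext fun y => featureMap_apply H x y
    rw [h]
    have h' := hmeas.comp (measurable_prodMk_left (x := x))
    simpa only [Function.comp_def] using h'
  have hspan : ∀ g ∈ Submodule.span ℝ (Set.range (featureMap H : 𝒳 → H)),
      Measurable fun x => g x := by
    intro g hg
    refine Submodule.span_induction (p := fun g _ => Measurable fun x : 𝒳 => g x) ?_ ?_ ?_ ?_ hg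
    · rintro _ ⟨x, rfl⟩
      exact hker x
    · have h : (fun x : 𝒳 => (0 : H) x) = fun _ => 0 := funext fun x => by simp
      rw [h]
      exact measurable_const
    · intro g g' _ _ hg hg'
      have h : (fun x : 𝒳 => (g + g') x) = fun x => g x + g' x := funext fun x => by simp
      rw [h]
      exact hg.add hg'
    · intro c g _ hg
      have h : (fun x : 𝒳 => (c • g) x) = fun x => c * g x := funext fun x => by simp
      rw [h]
      exact hg.const_mul c
  obtain ⟨u, hu, hlim⟩ := mem_closure_iff_seq_limit.1 (dense_span_featureMap (H := H) f)
  exact measurable_of_tendsto_metrizable (fun i => hspan (u i) (hu i)) (tendsto_pi_nhds.2 fun x =>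
    ((RKHS.continuous_eval x).tendsto f).comp hlim)

omit [MeasurableSpace 𝒳] in
theorem exists_norm_featureMap_le
    (hA1 : BddAbove (Set.range fun z : 𝒳 × 𝒳 => kern H z.1 z.2)) :
    ∃ C, ∀ x : 𝒳, ‖featureMap H x‖ ≤ C := by
  obtain ⟨C, hC⟩ := hA1
  refine ⟨√C, fun x => Real.le_sqrt_of_sq_le ?_⟩
  rw [← real_inner_self_eq_norm_sq, ← kern_eq_inner]
  exact hC ⟨(x, x), rfl⟩

variable (P : Measure 𝒳) [IsProbabilityMeasure P]

theorem integrable_coe (hmeas : Measurable fun z : 𝒳 × 𝒳 => kern H z.1 z.2)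
    (hA1 : BddAbove (Set.range fun z : 𝒳 × 𝒳 => kern H z.1 z.2)) (f : H) :
    Integrable (fun x => f x) P := by
  obtain ⟨C, hC⟩ := exists_norm_featureMap_le hA1
  refine Integrable.of_bound (measurable_coe hmeas f).aestronglyMeasurable (‖f‖ * C)
    (ae_of_all _ fun x => ?_)
  rw [← inner_featureMap]
  exact (norm_inner_le_norm _ _).trans (mul_le_mul_of_nonneg_left (hC x) (norm_nonneg f))

/-- Boundedness of the feature map makes `f ↦ ∫ f dP` a continuous functional, and the Riesz theorem
represents it. -/
theorem isMeanElement_meanElement (hmeas : Measurable fun z : 𝒳 × 𝒳 => kern H z.1 z.2)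
    (hA1 : BddAbove (Set.range fun z : 𝒳 × 𝒳 => kern H z.1 z.2)) :
    IsMeanElement H P (meanElement H P) := by
  have hex : ∃ m : H, IsMeanElement H P m := by
    obtain ⟨C, hC⟩ := exists_norm_featureMap_le hA1
    have hint := integrable_coe (H := H) P hmeas hA1
    let T : H →L[ℝ] ℝ := LinearMap.mkContinuous
      { toFun := fun f => ∫ x, f x ∂P
        map_add' := fun f g => by
          rw [← integral_add (hint f) (hint g)]
          simp
        map_smul' := fun c f => by
          rw [RingHom.id_apply, ← integral_smul]
          simp }
      C fun f => by
        have h := norm_integral_le_of_norm_le_const (μ := P) (f := fun x => f x) (C := ‖f‖ * C)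
          (ae_of_all _ fun x => by
            rw [← inner_featureMap]
            exact (norm_inner_le_norm _ _).trans
              (mul_le_mul_of_nonneg_left (hC x) (norm_nonneg f)))
        simpa [mul_comm] using h
    refine ⟨(InnerProductSpace.toDual ℝ H).symm T, fun f => ⟨hint f, ?_⟩⟩
    rw [InnerProductSpace.toDual_symm_apply]
    rfl
  rw [meanElement, dif_pos hex]
  exact hex.choose_spec

/-- The centered feature map `Φ x - m`. -/
def centeredFeature (x : 𝒳) : H := featureMap H x - meanElement H P

omit [IsProbabilityMeasure P] in
theorem inner_centeredFeature (f : H) (x : 𝒳) :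
    inner ℝ f (centeredFeature P x : H) = f x - inner ℝ (meanElement H P) f := by
  rw [centeredFeature, inner_sub_right, inner_featureMap, real_inner_comm]

omit [IsProbabilityMeasure P] in
/-- The kernel differs from the centered one by functions of one variable. -/
theorem kern_eq_centeredKern_add (x y : 𝒳) :
    kern H x y = centeredKern H P x y + meanElement H P x + meanElement H P y -
      ‖meanElement H P‖ ^ 2 := by
  rw [centeredKern, inner_sub_left, inner_sub_right, inner_sub_right, ← kern_eq_inner,
    real_inner_comm, inner_featureMap, inner_featureMap, real_inner_self_eq_norm_sq]
  ring

omit [IsProbabilityMeasure P] in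
theorem exists_isBoundedFeature_centeredFeature
    (hmeas : Measurable fun z : 𝒳 × 𝒳 => kern H z.1 z.2)
    (hA1 : BddAbove (Set.range fun z : 𝒳 × 𝒳 => kern H z.1 z.2)) :
    ∃ B, IsBoundedFeature (centeredFeature P : 𝒳 → H) B := by
  obtain ⟨C, hC⟩ := exists_norm_featureMap_le hA1
  refine ⟨C + ‖meanElement H P‖, fun f => ?_, ?_, fun x => ?_⟩
  · simp only [inner_centeredFeature]
    exact (measurable_coe hmeas f).sub_const _
  · have h : ∀ z : 𝒳 × 𝒳, inner ℝ (centeredFeature P z.1 : H) (centeredFeature P z.2) =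
        kern H z.1 z.2 - meanElement H P z.1 - meanElement H P z.2 + ‖meanElement H P‖ ^ 2 := by
      intro z
      rw [kern_eq_centeredKern_add P z.1 z.2, centeredKern, centeredFeature, centeredFeature]
      ring
    simp only [h]
    have hm := measurable_coe hmeas (meanElement H P)
    exact ((hmeas.sub (hm.comp measurable_fst)).sub (hm.comp measurable_snd)).add_const _
  · exact (norm_sub_le _ _).trans (add_le_add_left (hC x) _)

theorem integral_inner_centeredFeature (hmeas : Measurable fun z : 𝒳 × 𝒳 => kern H z.1 z.2)
    (hA1 : BddAbove (Set.range fun z : 𝒳 × 𝒳 => kern H z.1 z.2)) (f : H) :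
    ∫ x, inner ℝ f (centeredFeature P x : H) ∂P = 0 := by
  have h := isMeanElement_meanElement P hmeas hA1 f
  simp only [inner_centeredFeature]
  rw [integral_sub h.1 (integrable_const _), h.2]
  simp

theorem isDegenerateKernel_centeredKern (hmeas : Measurable fun z : 𝒳 × 𝒳 => kern H z.1 z.2)
    (hA1 : BddAbove (Set.range fun z : 𝒳 × 𝒳 => kern H z.1 z.2)) :
    IsDegenerateKernel (centeredKern H P) P := by
  obtain ⟨B, hB⟩ := exists_isBoundedFeature_centeredFeature (H := H) P hmeas hA1
  refine ⟨hB.measurable_gram, ⟨B * B, fun x y => ?_⟩, fun x y => real_inner_comm _ _,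
    fun x => integral_inner_centeredFeature P hmeas hA1 _⟩
  exact (hB.abs_inner_le _ y).trans
    (mul_le_mul_of_nonneg_left (hB.norm_le x) ((norm_nonneg _).trans (hB.norm_le x)))

theorem exists_isEigenExpansion_centeredKern
    (hmeas : Measurable fun z : 𝒳 × 𝒳 => kern H z.1 z.2)
    (hA1 : BddAbove (Set.range fun z : 𝒳 × 𝒳 => kern H z.1 z.2)) {lam : ℕ → ℝ}
    (hlam : IsEigenvalueSeq (centeredKern H P) P lam) :
    ∃ φ : ℕ → 𝒳 → ℝ, IsEigenExpansion (centeredKern H P) P lam φ := by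
  obtain ⟨B, hB⟩ := exists_isBoundedFeature_centeredFeature (H := H) P hmeas hA1
  obtain ⟨g, hsum, horth, hlim⟩ := hB.exists_eigenfunctions P hlam
  exact ⟨fun p x => inner ℝ (g p) (centeredFeature P x), hsum,
    fun p => hB.measurable_inner _, fun p => ⟨B * ‖g p‖, hB.abs_inner_le _⟩,
    fun p => integral_inner_centeredFeature P hmeas hA1 _, horth, hlim⟩

end Centering

/-! ### The statistics as quadratic forms in pair sums -/

section StatisticAlgebra

variable {𝒳 Ω : Type*} {k : ℕ}

theorem sum_sum_erase {m : ℕ} (f : ℕ → ℕ → ℝ) :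
    ∑ i ∈ Finset.range m, ∑ r ∈ (Finset.range m).erase i, f i r =
      ∑ i ∈ Finset.range m, ∑ r ∈ Finset.range m, f i r - ∑ i ∈ Finset.range m, f i i := by
  rw [← Finset.sum_sub_distrib]
  refine Finset.sum_congr rfl fun i hi => ?_
  rw [eq_sub_iff_add_eq, Finset.sum_erase_add _ _ hi]

/-- The statistic does not change when functions of one variable are added to the kernel. -/
theorem mmdU_eq_of_kernel_eq {K K' : 𝒳 → 𝒳 → ℝ} {a : 𝒳 → ℝ} {b : ℝ}
    (hK : ∀ x y, K x y = K' x y + a x + a y - b) (X : Fin k → ℕ → Ω → 𝒳) {n : Fin k → ℕ}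
    (hn : ∀ j, 2 ≤ n j) (j l : Fin k) (ω : Ω) : mmdU K X n j l ω = mmdU K' X n j l ω := by
  have hpos : ∀ j, (n j : ℝ) ≠ 0 ∧ (n j : ℝ) - 1 ≠ 0 := fun j => by
    have h : (2 : ℝ) ≤ n j := by exact_mod_cast hn j
    constructor <;> linarith
  -- With `A_j` the average of `a` over the sample `j`, the within-sample terms gain `2 A_j - b` and
  -- `2 A_l - b`, and the cross term gains `A_j + A_l - b`. Counted with the factor `-2`, the latter
  -- cancels the former.
  have hU : ∀ j, ∑ i ∈ Finset.range (n j), ∑ r ∈ (Finset.range (n j)).erase i,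
      1 / ((n j : ℝ) * ((n j : ℝ) - 1)) * K (X j i ω) (X j r ω) =
      ∑ i ∈ Finset.range (n j), ∑ r ∈ (Finset.range (n j)).erase i,
        1 / ((n j : ℝ) * ((n j : ℝ) - 1)) * K' (X j i ω) (X j r ω) +
      (2 * (∑ i ∈ Finset.range (n j), a (X j i ω)) / n j - b) := by
    intro j
    obtain ⟨h1, h2⟩ := hpos j
    rw [sum_sum_erase, sum_sum_erase]
    simp only [hK, ← Finset.mul_sum, Finset.sum_add_distrib,
      Finset.sum_sub_distrib, Finset.sum_const, Finset.card_range, nsmul_eq_mul]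
    field_simp
    ring
  have hV : ∑ i ∈ Finset.range (n j), ∑ r ∈ Finset.range (n l),
      1 / ((n j : ℝ) * (n l : ℝ)) * K (X j i ω) (X l r ω) =
      ∑ i ∈ Finset.range (n j), ∑ r ∈ Finset.range (n l),
        1 / ((n j : ℝ) * (n l : ℝ)) * K' (X j i ω) (X l r ω) +
      ((∑ i ∈ Finset.range (n j), a (X j i ω)) / n j +
        (∑ i ∈ Finset.range (n l), a (X l i ω)) / n l - b) := by
    obtain ⟨h1, -⟩ := hpos j
    obtain ⟨h2, -⟩ := hpos l
    simp only [hK, ← Finset.mul_sum, Finset.sum_add_distrib,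
      Finset.sum_sub_distrib, Finset.sum_const, Finset.card_range, nsmul_eq_mul]
    field_simp
    ring
  rw [mmdU, mmdU, hU, hU, hV]
  ring

theorem mmdU_eq_crossStat (K : 𝒳 → 𝒳 → ℝ) (X : Fin k → ℕ → Ω → 𝒳) (n : Fin k → ℕ)
    {j l : Fin k} (hjl : j ≠ l) (ω : Ω) :
    mmdU K X n j l ω = crossStat K X n j j ω / ((n j : ℝ) - 1) +
      crossStat K X n l l ω / ((n l : ℝ) - 1) -
      2 * ((√(n j))⁻¹ * (√(n l))⁻¹) * crossStat K X n j l ω := by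
  have hsq : ∀ j, (√(n j : ℝ))⁻¹ * (√(n j))⁻¹ = (n j : ℝ)⁻¹ := fun j => by
    rw [← mul_inv, Real.mul_self_sqrt (Nat.cast_nonneg _)]
  have hU : ∀ j, ∑ i ∈ Finset.range (n j), ∑ r ∈ (Finset.range (n j)).erase i,
      1 / ((n j : ℝ) * ((n j : ℝ) - 1)) * K (X j i ω) (X j r ω) =
      crossStat K X n j j ω / ((n j : ℝ) - 1) := by
    intro j
    have h1 : ∀ i ∈ Finset.range (n j), ∑ r ∈ (Finset.range (n j)).erase i,
        K (X j i ω) (X j r ω) = ∑ r ∈ Finset.range (n j),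
          if (j, i) = (j, r) then 0 else K (X j i ω) (X j r ω) := by
      intro i hi
      rw [← Finset.sum_erase_add _ _ hi, if_pos rfl, add_zero]
      refine Finset.sum_congr rfl fun r hr => ?_
      rw [if_neg]
      simpa using (Finset.ne_of_mem_erase hr).symm
    simp only [← Finset.mul_sum]
    rw [Finset.sum_congr rfl h1, crossStat, hsq, one_div, mul_inv]
    ring
  have hV : ∑ i ∈ Finset.range (n j), ∑ r ∈ Finset.range (n l),
      1 / ((n j : ℝ) * (n l : ℝ)) * K (X j i ω) (X l r ω) =
      (√(n j))⁻¹ * (√(n l))⁻¹ * crossStat K X n j l ω := by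
    have h2 : ∀ i r : ℕ, (j, i) ≠ (l, r) := fun i r h => hjl (Prod.mk.inj h).1
    simp only [← Finset.mul_sum, crossStat, h2, if_false]
    rw [one_div, mul_inv, ← hsq, ← hsq]
    ring
  rw [mmdU, hU, hU, hV]
  ring

theorem sum_sum_erase_univ_right (u : Fin k → ℝ) :
    ∑ j, ∑ l ∈ Finset.univ.erase j, u l = ((k : ℝ) - 1) * ∑ j, u j := by
  have h : ∀ j, ∑ l ∈ Finset.univ.erase j, u l = ∑ l, u l - u j := fun j => by
    rw [eq_sub_iff_add_eq, Finset.sum_erase_add _ _ (Finset.mem_univ j)]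
  simp only [h, Finset.sum_sub_distrib, Finset.sum_const, Finset.card_univ, Fintype.card_fin,
    nsmul_eq_mul]
  ring

/-- The coefficients of `n T̂` in terms of the normalized pair sums. -/
def testCoef (n : Fin k → ℕ) (j l : Fin k) : ℝ :=
  if j = l then (totalSize n + ((k : ℝ) - 2) * n j) / ((n j : ℝ) - 1)
  else -2 * (√(n l) * (√(n j))⁻¹)

theorem totalSize_pos [Nonempty (Fin k)] {n : Fin k → ℕ} (hn : ∀ j, 2 ≤ n j) :
    0 < totalSize n :=
  Finset.sum_pos (fun j _ => by exact_mod_cast (hn j).trans_lt' (by norm_num))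
    Finset.univ_nonempty

theorem totalSize_mul_testStat (K : 𝒳 → 𝒳 → ℝ) (X : Fin k → ℕ → Ω → 𝒳) {n : Fin k → ℕ}
    (hn : ∀ j, 2 ≤ n j) (ω : Ω) :
    totalSize n * testStat K X n ω = quadStat K X n (testCoef n) ω := by
  rcases isEmpty_or_nonempty (Fin k) with hk | hk
  · simp [testStat, quadStat]
  have hN := (totalSize_pos hn).ne'
  have hpos : ∀ j, (n j : ℝ) ≠ 0 ∧ (n j : ℝ) - 1 ≠ 0 ∧ √(n j : ℝ) ≠ 0 := fun j => by
    have h : (2 : ℝ) ≤ n j := by exact_mod_cast hn j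
    exact ⟨by linarith, by linarith, (Real.sqrt_pos.2 (by linarith)).ne'⟩
  have h1 : totalSize n * testStat K X n ω = ∑ j, ∑ l ∈ Finset.univ.erase j,
      (n l * (crossStat K X n j j ω / ((n j : ℝ) - 1)) +
        n l * (crossStat K X n l l ω / ((n l : ℝ) - 1)) +
        -2 * (√(n l) * (√(n j))⁻¹) * crossStat K X n j l ω) := by
    rw [testStat, Finset.mul_sum]
    refine Finset.sum_congr rfl fun j _ => ?_
    rw [Finset.mul_sum]
    refine Finset.sum_congr rfl fun l hl => ?_
    rw [mmdU_eq_crossStat K X n (Finset.ne_of_mem_erase hl).symm]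
    have h2 : (n l : ℝ) * (√(n l))⁻¹ = √(n l) := by
      nth_rewrite 1 [← Real.mul_self_sqrt (Nat.cast_nonneg (n l))]
      rw [mul_assoc, mul_inv_cancel₀ (hpos l).2.2, mul_one]
    have h3 : totalSize n * (n l / totalSize n) = n l := by field_simp
    have h6 : -2 * (√(n l) * (√(n j))⁻¹) = -2 * (n l * (√(n l))⁻¹ * (√(n j))⁻¹) := by rw [h2]
    rw [← mul_assoc, h3, h6]
    ring
  -- The pair sum inside the sample `j` has total weight `n - n_j` as first index and `(k - 1) n_j`
  -- as second index. Together these give the numerator `n + (k - 2) n_j` of `testCoef`.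
  have h4 : ∀ j, ∑ l ∈ Finset.univ.erase j, (n l : ℝ) = totalSize n - n j := fun j => by
    rw [eq_sub_iff_add_eq, Finset.sum_erase_add _ _ (Finset.mem_univ j), totalSize]
  rw [h1]
  simp only [Finset.sum_add_distrib, ← Finset.sum_mul, h4]
  rw [sum_sum_erase_univ_right (fun l => n l * (crossStat K X n l l ω / ((n l : ℝ) - 1))),
    quadStat, Finset.mul_sum, ← Finset.sum_add_distrib, ← Finset.sum_add_distrib]
  refine Finset.sum_congr rfl fun j _ => ?_
  rw [← Finset.sum_erase_add _ _ (Finset.mem_univ j), testCoef, if_pos rfl]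
  have h5 : ∑ l ∈ Finset.univ.erase j, testCoef n j l * crossStat K X n j l ω =
      ∑ l ∈ Finset.univ.erase j, -2 * (√(n l) * (√(n j))⁻¹) * crossStat K X n j l ω :=
    Finset.sum_congr rfl fun l hl => by
      rw [testCoef, if_neg (Finset.ne_of_mem_erase hl).symm]
  rw [h5]
  ring

theorem quadTerm_eq_limitTerm (lam : ℕ → ℝ) (ρ : Fin k → ℝ) (Y : ℕ → Fin k → Ω → ℝ) (p : ℕ)
    (ω : Ω) :
    quadTerm lam (fun j l => if j = l then (ρ j)⁻¹ + ((k : ℝ) - 2)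
      else -2 * (√(ρ l) * (√(ρ j))⁻¹)) Y p ω = limitTerm lam ρ Y p ω := by
  rw [quadTerm, limitTerm]
  congr 1
  have h1 : sumSq Y p ω - k = ∑ j, (Y p j ω ^ 2 - 1) := by
    simp [sumSq, Finset.sum_sub_distrib]
  rw [h1, Finset.mul_sum, ← Finset.sum_add_distrib]
  refine Finset.sum_congr rfl fun j _ => ?_
  rw [← Finset.sum_erase_add _ _ (Finset.mem_univ j), if_pos rfl, if_pos rfl]
  have h2 : ∑ l ∈ Finset.univ.erase j, (if j = l then (ρ j)⁻¹ + ((k : ℝ) - 2)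
      else -2 * (√(ρ l) * (√(ρ j))⁻¹)) * (Y p j ω * Y p l ω - if j = l then 1 else 0) =
      -2 * ∑ l ∈ Finset.univ.erase j, √(ρ l) * (√(ρ j))⁻¹ * Y p j ω * Y p l ω := by
    rw [Finset.mul_sum]
    refine Finset.sum_congr rfl fun l hl => ?_
    rw [if_neg (Finset.ne_of_mem_erase hl).symm, if_neg (Finset.ne_of_mem_erase hl).symm]
    ring
  rw [h2]
  ring

/-- The coefficients of `n Γ̂_{ij}` for two samples in terms of the normalized pair sums. -/
def pairCoef (i : Fin k) (n : Fin k → ℕ) (a b : Fin k) : ℝ :=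
  if a = b then totalSize n / ((n a : ℝ) - 1)
  else if a = i then -2 * (totalSize n * ((√(n a))⁻¹ * (√(n b))⁻¹)) else 0

theorem sum_fin_two {i j : Fin k} (hk : k = 2) (hij : i ≠ j) (f : Fin k → ℝ) :
    ∑ a, f a = f i + f j := by
  subst hk
  rw [Fin.sum_univ_two]
  fin_cases i <;> fin_cases j <;> simp_all [add_comm]

/-- The cross term occurs once, with its factor `2`, so it is assigned to the ordered pair `(i, j)`
alone and `pairCoef` is not symmetric. -/
theorem totalSize_mul_mmdU (hk : k = 2) {i j : Fin k} (hij : i ≠ j) (K : 𝒳 → 𝒳 → ℝ)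
    (X : Fin k → ℕ → Ω → 𝒳) (n : Fin k → ℕ) (ω : Ω) :
    totalSize n * mmdU K X n i j ω = quadStat K X n (pairCoef i n) ω := by
  rw [mmdU_eq_crossStat K X n hij, quadStat, sum_fin_two hk hij, sum_fin_two hk hij,
    sum_fin_two hk hij]
  simp only [pairCoef, if_true, hij, hij.symm, if_false]
  ring

/-- Expanding the square leaves the constant `ρ_i⁻¹ + ρ_j⁻¹`, which equals `(ρ_i ρ_j)⁻¹` because
`ρ_i + ρ_j = 1`. -/
theorem quadTerm_pair (hk : k = 2) {i j : Fin k} (hij : i ≠ j) (lam : ℕ → ℝ) {ρ : Fin k → ℝ}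
    (hρ : ∀ j, 0 < ρ j) (hsum : ∑ j, ρ j = 1) (Y : ℕ → Fin k → Ω → ℝ) (p : ℕ) (ω : Ω) :
    quadTerm lam (fun a b => if a = b then (ρ a)⁻¹
      else if a = i then -2 * ((√(ρ a))⁻¹ * (√(ρ b))⁻¹) else 0) Y p ω =
      lam p * (((√(ρ i))⁻¹ * Y p i ω - (√(ρ j))⁻¹ * Y p j ω) ^ 2 - (ρ i * ρ j)⁻¹) := by
  rw [quadTerm, sum_fin_two hk hij, sum_fin_two hk hij, sum_fin_two hk hij]
  rw [sum_fin_two hk hij] at hsum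
  simp only [if_true, hij, hij.symm, if_false]
  have hsq : ∀ j, (√(ρ j))⁻¹ ^ 2 = (ρ j)⁻¹ := fun j => by
    rw [inv_pow, Real.sq_sqrt (hρ j).le]
  have h1 : (ρ i * ρ j)⁻¹ = (ρ i)⁻¹ + (ρ j)⁻¹ := by
    have hi := (hρ i).ne'
    have hj := (hρ j).ne'
    field_simp
    linarith
  rw [h1, sub_sq, mul_pow, mul_pow, hsq, hsq]
  ring

end StatisticAlgebra

/-! ### Limits of the coefficients -/

section Coefficients

variable {k : ℕ} {n : ℕ → Fin k → ℕ} {ρ : Fin k → ℝ}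

theorem eventually_two_le (hn : ∀ j, Tendsto (fun N => n N j) atTop atTop) :
    ∀ᶠ N in atTop, ∀ j, 2 ≤ n N j :=
  eventually_all.2 fun j => (hn j).eventually_ge_atTop 2

theorem tendsto_div_sub_one (hn : ∀ j, Tendsto (fun N => n N j) atTop atTop) (j : Fin k) :
    Tendsto (fun N => (n N j : ℝ) / ((n N j : ℝ) - 1)) atTop (𝓝 1) := by
  have h0 : Tendsto (fun N => ((n N j : ℝ))⁻¹) atTop (𝓝 0) :=
    tendsto_inv_atTop_zero.comp (tendsto_natCast_atTop_atTop.comp (hn j))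
  have h1 := (h0.const_sub 1).inv₀ (by norm_num)
  rw [sub_zero, inv_one] at h1
  refine h1.congr' ?_
  filter_upwards [eventually_two_le hn] with N hN
  have h : (2 : ℝ) ≤ n N j := by exact_mod_cast hN j
  have h2 : (n N j : ℝ) ≠ 0 := by linarith
  have h3 : (n N j : ℝ) - 1 ≠ 0 := by linarith
  field_simp

variable (hn : ∀ j, Tendsto (fun N => n N j) atTop atTop) (hρ : ∀ j, 0 < ρ j)
  (hA2 : ∀ j, Tendsto (fun N => (n N j : ℝ) / totalSize (n N)) atTop (𝓝 (ρ j)))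

include hn hA2

theorem sum_limit_eq_one [Nonempty (Fin k)] : ∑ j, ρ j = 1 := by
  have h1 : Tendsto (fun N => ∑ j, (n N j : ℝ) / totalSize (n N)) atTop (𝓝 (∑ j, ρ j)) :=
    tendsto_finsetSum _ fun j _ => hA2 j
  refine tendsto_nhds_unique h1 (tendsto_const_nhds.congr' ?_)
  filter_upwards [eventually_two_le hn] with N hN
  rw [← Finset.sum_div]
  exact (div_self (totalSize_pos hN).ne').symm

include hρ

theorem tendsto_totalSize_div_sub_one (j : Fin k) :
    Tendsto (fun N => totalSize (n N) / ((n N j : ℝ) - 1)) atTop (𝓝 (ρ j)⁻¹) := by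
  have h1 := ((hA2 j).inv₀ (hρ j).ne').mul (tendsto_div_sub_one hn j)
  rw [mul_one] at h1
  refine h1.congr' ?_
  filter_upwards [eventually_two_le hn] with N hN
  have h : (2 : ℝ) ≤ n N j := by exact_mod_cast hN j
  have h2 : (n N j : ℝ) ≠ 0 := by linarith
  rw [inv_div, div_mul_div_comm, mul_comm (n N j : ℝ), mul_div_mul_right _ _ h2]

theorem tendsto_testCoef :
    Tendsto (fun N => testCoef (n N)) atTop (𝓝 fun j l => if j = l then (ρ j)⁻¹ + ((k : ℝ) - 2)
      else -2 * (√(ρ l) * (√(ρ j))⁻¹)) := by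
  refine tendsto_pi_nhds.2 fun j => tendsto_pi_nhds.2 fun l => ?_
  have : Nonempty (Fin k) := ⟨j⟩
  by_cases hjl : j = l
  · simp only [testCoef, hjl, if_true]
    have h1 := (tendsto_totalSize_div_sub_one hn hρ hA2 l).add
      ((tendsto_div_sub_one hn l).const_mul ((k : ℝ) - 2))
    rw [mul_one] at h1
    refine h1.congr fun N => ?_
    ring
  · simp only [testCoef, hjl, if_false]
    refine Tendsto.const_mul _ ?_
    have h1 := (hA2 l).sqrt.mul ((hA2 j).sqrt.inv₀ (Real.sqrt_pos.2 (hρ j)).ne')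
    refine h1.congr' ?_
    filter_upwards [eventually_two_le hn] with N hN
    have h2 : √(totalSize (n N)) ≠ 0 := (Real.sqrt_pos.2 (totalSize_pos hN)).ne'
    rw [Real.sqrt_div (Nat.cast_nonneg _), Real.sqrt_div (Nat.cast_nonneg _), inv_div]
    field_simp

theorem tendsto_pairCoef (i : Fin k) :
    Tendsto (fun N => pairCoef i (n N)) atTop (𝓝 fun a b => if a = b then (ρ a)⁻¹
      else if a = i then -2 * ((√(ρ a))⁻¹ * (√(ρ b))⁻¹) else 0) := by
  refine tendsto_pi_nhds.2 fun a => tendsto_pi_nhds.2 fun b => ?_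
  have : Nonempty (Fin k) := ⟨a⟩
  by_cases hab : a = b
  · simp only [pairCoef, hab, if_true]
    exact tendsto_totalSize_div_sub_one hn hρ hA2 b
  by_cases hai : a = i
  · simp only [pairCoef, hai, if_true]
    subst hai
    simp only [hab, if_false]
    refine Tendsto.const_mul _ ?_
    have h1 := ((hA2 a).sqrt.inv₀ (Real.sqrt_pos.2 (hρ a)).ne').mul
      ((hA2 b).sqrt.inv₀ (Real.sqrt_pos.2 (hρ b)).ne')
    refine h1.congr' ?_
    filter_upwards [eventually_two_le hn] with N hN
    have h2 := totalSize_pos hN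
    rw [Real.sqrt_div (Nat.cast_nonneg _), Real.sqrt_div (Nat.cast_nonneg _), inv_div, inv_div,
      div_mul_div_comm, Real.mul_self_sqrt h2.le, div_eq_mul_inv, mul_inv]
  · simp only [pairCoef, hab, hai, if_false]
    exact tendsto_const_nhds

end Coefficients

theorem measurable_mmdU {𝒳 Ω : Type*} [MeasurableSpace 𝒳] [MeasurableSpace Ω] {k : ℕ}
    {K : 𝒳 → 𝒳 → ℝ} (hK : Measurable fun z : 𝒳 × 𝒳 => K z.1 z.2) {X : Fin k → ℕ → Ω → 𝒳}
    (hX : ∀ j i, Measurable (X j i)) (n : Fin k → ℕ) (j l : Fin k) :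
    Measurable (mmdU K X n j l) := by
  have h : ∀ j i l r, Measurable fun ω => K (X j i ω) (X l r ω) := fun j i l r =>
    hK.comp ((hX j i).prodMk (hX l r))
  unfold mmdU
  fun_prop

end KSample

end

/-! ### The limit theorem -/

theorem theorem1
    {𝒳 : Type*} [MeasurableSpace 𝒳]
    -- a real reproducing kernel Hilbert space on `𝒳`, with a measurable kernel, bounded above
    (H : Type*) [NormedAddCommGroup H] [InnerProductSpace ℝ H] [CompleteSpace H]
    [RKHS ℝ H 𝒳 ℝ]
    (hmeas : Measurable fun z : 𝒳 × 𝒳 => KSample.kern H z.1 z.2)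
    (hA1 : BddAbove (Set.range fun z : 𝒳 × 𝒳 => KSample.kern H z.1 z.2))
    -- `k` independent i.i.d. samples, the `j`-th one with distribution `P j`
    {Ω : Type*} [MeasurableSpace Ω] (μ : Measure Ω) [IsProbabilityMeasure μ]
    (k : ℕ) (hk : 1 ≤ k) (P : Fin k → Measure 𝒳)
    (X : Fin k → ℕ → Ω → 𝒳)
    (hXmeas : ∀ j i, Measurable (X j i))
    (hXlaw : ∀ j i, HasLaw (X j i) (P j) μ)
    (hXindep : iIndepFun (fun q : Fin k × ℕ => X q.1 q.2) μ)
    -- the sample sizes, along any sequence with `min_j n_j → ∞` and `n_j / n → ρ_j ∈ (0, 1)`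
    (n : ℕ → Fin k → ℕ) (hn : ∀ j, Tendsto (fun N => n N j) atTop atTop)
    (ρ : Fin k → ℝ) (hρ : ∀ j, ρ j ∈ Set.Ioo (0 : ℝ) 1)
    (hA2 : ∀ j, Tendsto (fun N => (n N j : ℝ) / KSample.totalSize (n N)) atTop (𝓝 (ρ j)))
    -- the null hypothesis: all the distributions are equal, to `P₀`
    (P₀ : Measure 𝒳) (hH0 : ∀ j, P j = P₀)
    -- the eigenvalues of the integral operator of the centered kernel
    (lam : ℕ → ℝ) (hlam : KSample.IsEigenvalueSeq (KSample.centeredKern H P₀) P₀ lam)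
    -- independent standard normal variables
    {Ω' : Type*} [MeasurableSpace Ω'] (μ' : Measure Ω') [IsProbabilityMeasure μ']
    (Y : ℕ → Fin k → Ω' → ℝ)
    (hYlaw : ∀ p j, HasLaw (Y p j) (gaussianReal 0 1) μ')
    (hYindep : iIndepFun (fun q : ℕ × Fin k => Y q.1 q.2) μ') :
    (∀ p, HasLaw (KSample.sumSq Y p) (KSample.chiSquared k) μ')
    ∧ iIndepFun (KSample.sumSq Y) μ'
    ∧ (∀ᵐ ω ∂μ', Summable fun p => KSample.limitTerm lam ρ Y p ω)
    ∧ TendstoInDistribution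
        (fun N ω => KSample.totalSize (n N) * KSample.testStat (KSample.kern H) X (n N) ω) atTop
        (fun ω => ∑' p, KSample.limitTerm lam ρ Y p ω) (fun _ => μ) μ'
    ∧ (k = 2 → ∀ i j : Fin k, i ≠ j →
        (∀ᵐ ω ∂μ', Summable fun p => lam p *
            (((√(ρ i))⁻¹ * Y p i ω - (√(ρ j))⁻¹ * Y p j ω) ^ 2 - (ρ i * ρ j)⁻¹))
        ∧ TendstoInDistribution
            (fun N ω => KSample.totalSize (n N) * KSample.mmdU (KSample.kern H) X (n N) i j ω)
            atTop
            (fun ω => ∑' p, lam p *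
              (((√(ρ i))⁻¹ * Y p i ω - (√(ρ j))⁻¹ * Y p j ω) ^ 2 - (ρ i * ρ j)⁻¹))
            (fun _ => μ) μ') := by
  have hρ0 : ∀ j, 0 < ρ j := fun j => (hρ j).1
  have hlaw : ∀ j i, μ.map (X j i) = P₀ := fun j i => (hXlaw j i).map_eq.trans (hH0 j)
  -- As `k ≥ 1`, there is a sample with law `P₀`, so `P₀` is a probability measure.
  have hne : Nonempty (Fin k) := ⟨⟨0, hk⟩⟩
  have hP₀ : IsProbabilityMeasure P₀ := hlaw hne.some 0 ▸
    Measure.isProbabilityMeasure_map (hXmeas hne.some 0).aemeasurable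
  obtain ⟨φ, hφ⟩ := KSample.exists_isEigenExpansion_centeredKern P₀ hmeas hA1 hlam
  have hdeg := KSample.isDegenerateKernel_centeredKern (H := H) P₀ hmeas hA1
  -- Centering is valid only once all `n_j ≥ 2`, hence for large `N`. Measurability is required for
  -- every `N` and is therefore checked on the uncentered kernel.
  have hcent : ∀ N, (∀ j, 2 ≤ n N j) → ∀ i j ω, KSample.mmdU (KSample.kern H) X (n N) i j ω =
      KSample.mmdU (KSample.centeredKern H P₀) X (n N) i j ω := fun N hN i j ω =>
    KSample.mmdU_eq_of_kernel_eq (KSample.kern_eq_centeredKern_add P₀) X hN i j ω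
  refine ⟨KSample.hasLaw_sumSq hYlaw hYindep, KSample.iIndepFun_sumSq hYlaw hYindep, ?_, ?_,
    fun hk2 i j hij => ⟨?_, ?_⟩⟩
  · simp only [← KSample.quadTerm_eq_limitTerm]
    exact KSample.ae_summable_quadTerm hφ.summable _ hYlaw
  · simp only [← KSample.quadTerm_eq_limitTerm]
    refine hφ.tendstoInDistribution_quadStat hdeg hXmeas hlaw hXindep hn
      (KSample.tendsto_testCoef hn hρ0 hA2) hYlaw hYindep (fun N => ?_) ?_
    · exact (Finset.measurable_sum _ fun j _ => Finset.measurable_sum _ fun l _ =>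
        (KSample.measurable_mmdU hmeas hXmeas (n N) j l).const_mul _).const_mul _
    · filter_upwards [KSample.eventually_two_le hn] with N hN ω
      rw [← KSample.totalSize_mul_testStat _ X hN]
      simp only [KSample.testStat, hcent N hN]
  · simp only [← KSample.quadTerm_pair hk2 hij lam hρ0 (KSample.sum_limit_eq_one hn hA2)]
    exact KSample.ae_summable_quadTerm hφ.summable _ hYlaw
  · simp only [← KSample.quadTerm_pair hk2 hij lam hρ0 (KSample.sum_limit_eq_one hn hA2)]
    refine hφ.tendstoInDistribution_quadStat hdeg hXmeas hlaw hXindep hn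
      (KSample.tendsto_pairCoef hn hρ0 hA2 i) hYlaw hYindep (fun N => ?_) ?_
    · exact (KSample.measurable_mmdU hmeas hXmeas (n N) i j).const_mul _
    · filter_upwards [KSample.eventually_two_le hn] with N hN ω
      rw [← KSample.totalSize_mul_mmdU hk2 hij, hcent N hN]
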